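/- Let $n,N$ be positive integers, let $\Omega\subset\mathbb{R}^n$ be a bounded Lipschitz domain (bounded, open, connected, and near each boundary point, in suitable orthonormal coordinates, the strict epigraph of a Lipschitz function), and let $1<p<\infty$. Equip $\mathbb{R}^{N\times n}$ with the Euclidean (Frobenius) norm $|\cdot|$ and inner product $\langle\cdot,\cdot\rangle$, let $Q=(0,1)^n$, and put $V(\xi)=(1+|\xi|^2)^{\frac{p/2-1}{2}}\xi$ for $\xi\in\mathbb{R}^{N\times n}$. Here $W^{1,\infty}_0(Q,\mathbb{R}^N)=W^{1,\infty}(Q,\mathbb{R}^N)\cap W^{1,1}_0(Q,\mathbb{R}^N)$, and $C_0^\infty(\Omega,\mathbb{R}^N)$ is the set of smooth maps with compact support in $\Omega$. Let $F:\overline{\Omega}\times\mathbb{R}^{N\times n}\to\mathbb{R}$ be such that $F(\cdot,z)$ is Lebesgue measurable on $\Omega$ for every $z$, and ($\overline{\mathrm{H}}0$) $F(x,\cdot)$ is of class $C^2$ for every $x\in\overline\Omega$, and $F_{zz}$ is continuous on $\overline\Omega\times\mathbb{R}^{N\times n}$; ($\overline{\mathrm{H}}1$) there is $c_1>0$ with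 $|F(x,z)|\le c_1(1+|z|^p)$ for all $(x,z)\in\overline\Omega\times\mathbb{R}^{N\times n}$; ($\overline{\mathrm{H}}2$) there is $c_2>0$ such that for all $(x_0,z)\in\Omega\times\mathbb{R}^{N\times n}$ and all $\varphi\in W^{1,\infty}_0(Q,\mathbb{R}^N)$, $$c_2\int_Q|V(\nabla\varphi)|^2\,dx\le\int_Q\bigl(F(x_0,z+\nabla\varphi)-F(x_0,z)\bigr)\,dx.$$ Assume moreover that $F(x_0,\cdot)$ is quasiconvex for every $x_0\in\overline\Omega$, that is, $F(x_0,z)\le\int_Q F(x_0,z+\nabla\varphi)\,dx$ for all $z\in\mathbb{R}^{N\times n}$ and all $\varphi\in W_0^{1,\infty}(Q,\mathbb{R}^N)$. Let $\overline u\in W^{1,\infty}(\Omega,\mathbb{R}^N)$ and $c_3>0$ be such that, for all $\varphi\in C_0^\infty(\Omega,\mathbb{R}^N)$, $$\int_\Omega\langle F_z(x,\nabla\overline u),\nabla\varphi\rangle\,dx=0\quad\text{and}\quad c_3\int_\Omega|\nabla\varphi|^2\,dx\le\int_\Omega F_{zz}(x,\nabla\overline u)[\nabla\varphi,\nabla\varphi]\,dx.$$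 Then there is $\delta>0$ such that $$\int_\Omega F(x,\nabla\overline u)\,dx\le\int_\Omega F(x,\nabla\overline u+\nabla\varphi)\,dx$$ for every $\varphi\in C_0^\infty(\Omega,\mathbb{R}^N)$ with $[\nabla\varphi]_{\mathrm{BMO}(\Omega)}\le\delta$, where $$[f]_{\mathrm{BMO}(\Omega)}=\sup_{B(x,r)\subseteq\Omega}\frac{1}{|B(x,r)|}\int_{B(x,r)}\Bigl|f(y)-\frac{1}{|B(x,r)|}\int_{B(x,r)}f\Bigr|\,dy.$$ -/

import Mathlib

open MeasureTheory Metric Set Filter Topology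
open scoped ContDiff ENNReal

noncomputable section

/-- Euclidean space `ℝᵏ`. -/
abbrev Vec (k : ℕ) : Type := EuclideanSpace ℝ (Fin k)

/-- Real `N × n` matrices with the Euclidean (Frobenius) inner product and norm. -/
abbrev Mat (N n : ℕ) : Type := EuclideanSpace ℝ (Fin N × Fin n)

/-- The classical gradient `(∇φ)ᵢⱼ = ∂ⱼφᵢ`. -/
def grad {n N : ℕ} (φ : Vec n → Vec N) (x : Vec n) : Mat N n :=
  WithLp.toLp 2 fun ij => fderiv ℝ φ x (EuclideanSpace.single ij.2 1) ij.1

/-- `C_c^∞(Ω, E)`: smooth maps with compact support contained in `Ω`. -/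
structure IsTestMap {n : ℕ} {E : Type*} [NormedAddCommGroup E] [NormedSpace ℝ E]
    (Ω : Set (Vec n)) (φ : Vec n → E) : Prop where
  smooth : ContDiff ℝ ∞ φ
  compact : HasCompactSupport φ
  subset : tsupport φ ⊆ Ω

/-- A bounded Lipschitz domain: bounded, open, connected, and near each boundary point the
strict epigraph, in some direction `e`, of a Lipschitz function of the variables
orthogonal to `e`. -/
structure IsLipschitzDomain {n : ℕ} (Ω : Set (Vec n)) : Prop where
  isOpen : IsOpen Ω
  connected : IsConnected Ω
  bounded : Bornology.IsBounded Ω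
  graph : ∀ x₀ ∈ frontier Ω, ∃ (e : Vec n) (r : ℝ) (K : NNReal) (ψ : Vec n → ℝ),
    ‖e‖ = 1 ∧ 0 < r ∧ LipschitzWith K ψ ∧
      ∀ x ∈ ball x₀ r, (x ∈ Ω ↔ ψ (x - inner ℝ e x • e) < inner ℝ e x)

/-- `u ∈ W^{1,∞}(Ω, ℝᴺ)` with weak gradient `G`. -/
structure MemW1Inf {n N : ℕ} (Ω : Set (Vec n)) (u : Vec n → Vec N) (G : Vec n → Mat N n) :
    Prop where
  memLp : MemLp u ∞ (volume.restrict Ω)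
  memLp_grad : MemLp G ∞ (volume.restrict Ω)
  weak : ∀ η : Vec n → ℝ, IsTestMap Ω η → ∀ (i : Fin N) (j : Fin n),
    ∫ x in Ω, u x i * fderiv ℝ η x (EuclideanSpace.single j 1) = - ∫ x in Ω, G x (i, j) * η x

/-- `φ ∈ W₀^{1,∞}(Ω, ℝᴺ) = W^{1,∞} ∩ W₀^{1,1}` with weak gradient `G`, where `W₀^{1,1}` is the
closure of `C_c^∞` in `W^{1,1}`. -/
structure MemW1InfZero {n N : ℕ} (Ω : Set (Vec n)) (φ : Vec n → Vec N) (G : Vec n → Mat N n) :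
    Prop where
  memW1Inf : MemW1Inf Ω φ G
  approx : ∃ φs : ℕ → Vec n → Vec N, (∀ k, IsTestMap Ω (φs k)) ∧
    Tendsto (fun k => eLpNorm (fun x => φs k x - φ x) 1 (volume.restrict Ω)) atTop (𝓝 0) ∧
    Tendsto (fun k => eLpNorm (fun x => grad (φs k) x - G x) 1 (volume.restrict Ω)) atTop (𝓝 0)

/-- The open unit cube `(0,1)ⁿ`. -/
def unitCube (n : ℕ) : Set (Vec n) := {x | ∀ i, x i ∈ Ioo (0 : ℝ) 1}

/-- `V_β(ξ) = (1 + |ξ|²)^{(β-1)/2} ξ`. -/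
def auxV {N n : ℕ} (β : ℝ) (ξ : Mat N n) : Mat N n := (1 + ‖ξ‖ ^ 2) ^ ((β - 1) / 2) • ξ

/-- Morrey quasiconvexity (the cube has volume `1`). -/
def IsQuasiconvex {N n : ℕ} (f : Mat N n → ℝ) : Prop :=
  ∀ (z : Mat N n) (φ : Vec n → Vec N) (G : Vec n → Mat N n), MemW1InfZero (unitCube n) φ G →
    f z ≤ ∫ x in unitCube n, f (z + G x)

/-- The Hessian `F_zz(x, z)` of `F(x, ·)`, as a bilinear form. -/
def hessZ {N n : ℕ} (F : Vec n → Mat N n → ℝ) (x : Vec n) (z : Mat N n) :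
    Mat N n →L[ℝ] Mat N n →L[ℝ] ℝ :=
  fderiv ℝ (fderiv ℝ (F x)) z

/-- Regularity of the integrand: `F(x, ·)` is `C²` and `F_zz` is jointly continuous on
`closure Ω × ℝ^{N×n}`; and `F(·, z)` is Lebesgue measurable, so that the functional makes sense. -/
structure HypReg {N n : ℕ} (Ω : Set (Vec n)) (F : Vec n → Mat N n → ℝ) : Prop where
  contDiff : ∀ x ∈ closure Ω, ContDiff ℝ 2 (F x)
  continuous_hess :
    ContinuousOn (fun q : Vec n × Mat N n => hessZ F q.1 q.2) (closure Ω ×ˢ univ)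
  measurable : ∀ z, AEStronglyMeasurable (fun x => F x z) (volume.restrict Ω)

/-- `p`-growth. -/
def HypGrowth {N n : ℕ} (Ω : Set (Vec n)) (p : ℝ) (F : Vec n → Mat N n → ℝ) : Prop :=
  ∃ c₁ : ℝ, 0 < c₁ ∧ ∀ x ∈ closure Ω, ∀ z, |F x z| ≤ c₁ * (1 + ‖z‖ ^ p)

/-- Strong `p`-quasiconvexity. -/
def HypStrongQC {N n : ℕ} (Ω : Set (Vec n)) (p : ℝ) (F : Vec n → Mat N n → ℝ) : Prop :=
  ∃ c₂ : ℝ, 0 < c₂ ∧ ∀ x₀ ∈ Ω, ∀ (z : Mat N n) (φ : Vec n → Vec N) (G : Vec n → Mat N n),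
    MemW1InfZero (unitCube n) φ G →
      c₂ * ∫ x in unitCube n, ‖auxV (p / 2) (G x)‖ ^ 2 ≤
        ∫ x in unitCube n, (F x₀ (z + G x) - F x₀ z)

/-- The seminorm `[f]_{BMO(Ω)}`: the supremum of the mean oscillations of `f` over all balls
contained in `Ω`. -/
def bmoSeminorm {n : ℕ} {E : Type*} [NormedAddCommGroup E] [NormedSpace ℝ E]
    (Ω : Set (Vec n)) (f : Vec n → E) : ℝ≥0∞ :=
  ⨆ (x : Vec n) (r : ℝ) (_ : 0 < r) (_ : ball x r ⊆ Ω),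
    ⨍⁻ y in ball x r, ‖f y - ⨍ w in ball x r, f w ∂volume‖ₑ ∂volume

end

/-! Put q = ⌈p⌉ + 3. The second-order Taylor expansion of F(x,·) at ∇ū has a remainder of at most
(c₃/4)|ξ|² + C|ξ|^q, uniformly in x (`exists_remainder_bound`): uniform continuity of F_zz on
compact sets handles small ξ, p-growth handles the rest. For ξ = ∇φ the first-order term integrates
to zero and half the second variation is at least (c₃/2)∫|∇φ|². It remains to show C∫|∇φ|^q ≤
(c₃/4)∫|∇φ|².

This is an interpolation between BMO and L² (`IsLipschitzDomain.lintegral_pow_le_mul_lintegral_sq`):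
if f has mean zero on Ω and small seminorm, then ∫|f|^q ≤ ε∫|f|². It follows from a good-λ argument.
At every level that is not too small relative to the seminorm, a Vitali family of stopping balls
gives a weak-type estimate (`sq_mul_measure_le`). Summation over dyadic levels yields the strong
estimate, up to a term that is absorbed (`lintegral_pow_le_of_weak_estimate`). The stopping
procedure can start because averages at a fixed scale are small
(`IsLipschitzDomain.exists_lintegral_le_bmoSeminorm`, by chaining through the connected domain).

The stopping balls are centred in Ω but may leave it, whereas the seminorm sees only balls inside Ω.
The gap is closed by `HasOscillationBound`, whose boundary case is
`IsNearGraph.exists_lintegral_ball_le`: values near the Lipschitz graph are compared with values on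
an interior ball by translating away from the graph in small steps. The errors are proportional to
volumes of slabs that shrink geometrically towards the graph, so they are summable. -/

/-! ### Mean oscillation under small translations -/

section Oscillation

variable {n : ℕ} {E : Type*} [NormedAddCommGroup E] [NormedSpace ℝ E]

lemma lintegral_sub_average_le_bmoSeminorm {Ω : Set (Vec n)} (f : Vec n → E) {x : Vec n} {r : ℝ}
    (hr : 0 < r) (hB : ball x r ⊆ Ω) :
    ∫⁻ y in ball x r, ‖f y - ⨍ w in ball x r, f w‖ₑ ≤ bmoSeminorm Ω f * volume (ball x r) := by
  have h1 : ⨍⁻ y in ball x r, ‖f y - ⨍ w in ball x r, f w ∂volume‖ₑ ∂volume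
      ≤ bmoSeminorm Ω f := by
    unfold bmoSeminorm
    exact le_iSup_of_le x (le_iSup_of_le r (le_iSup_of_le hr (le_iSup_of_le hB le_rfl)))
  rw [setLAverage_eq] at h1
  have h2 := (ENNReal.div_le_iff (measure_ball_pos volume x hr).ne' measure_ball_lt_top.ne).1 h1
  exact h2

lemma stronglyMeasurable_average_ball {f : Vec n → E} (hf : Continuous f) (s : ℝ) :
    StronglyMeasurable (fun w : Vec n => ⨍ z in ball w s, f z) := by
  have h : ∀ w : Vec n, ⨍ z in ball w s, f z
      = (volume.real (ball (0 : Vec n) s))⁻¹ • ∫ v in ball (0 : Vec n) s, f (w + v) := by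
    intro w
    rw [setAverage_eq]
    congr 1
    · simp [Measure.real, Measure.addHaar_ball_center]
    · have := (measurePreserving_add_left (volume : Measure (Vec n)) w).setIntegral_preimage_emb
        (MeasurableEquiv.addLeft w).measurableEmbedding f (ball w s)
      rw [← this]
      congr 2
      simp
  simp_rw [h]
  refine StronglyMeasurable.const_smul ?_ _
  have : StronglyMeasurable (fun q : Vec n × Vec n => f (q.1 + q.2)) :=
    (hf.comp (by fun_prop)).stronglyMeasurable
  exact this.integral_prod_right

lemma volume_ball_mul (x y : Vec n) {r k : ℝ} (hk : 0 < k) :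
    volume (ball x (k * r)) = ENNReal.ofReal k ^ n * volume (ball y r) := by
  rw [Measure.addHaar_ball_center, Measure.addHaar_ball_mul_of_pos volume 0 hk,
    Measure.addHaar_ball_center volume y]
  simp [ENNReal.ofReal_pow hk.le]

/-- If w is within s of y, then y and y + v both lie in B(w, 2s), so |f(y) - f(y+v)| is at most the
sum of the deviations of f at these points from its mean on B(w, 2s). Integrate over such w and over
y ∈ L, exchange the integrals, and apply the BMO bound on each B(w, 2s). The constant is 2 · 2ⁿ: two
deviations, and the volume ratio of B(w, 2s) to B(w, s). -/
lemma lintegral_shift_le {Ω : Set (Vec n)} {f : Vec n → E} (hf : Continuous f)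
    {L : Set (Vec n)} (hL : MeasurableSet L) {s : ℝ} (hs : 0 < s) {v : Vec n} (hv : ‖v‖ ≤ s)
    (hΩ : ∀ w ∈ thickening s L, ball w (2 * s) ⊆ Ω) :
    ∫⁻ y in L, ‖f y - f (y + v)‖ₑ ≤ 2 ^ (n + 1) * bmoSeminorm Ω f * volume (thickening s L) := by
  set m : Vec n → E := fun w => ⨍ z in ball w (2 * s), f z with hm
  have hmm : StronglyMeasurable m := stronglyMeasurable_average_ball hf _
  set V := volume (ball (0 : Vec n) s) with hV
  have hV0 : V ≠ 0 := (measure_ball_pos volume _ hs).ne'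
  have hVt : V ≠ ⊤ := measure_ball_lt_top.ne
  set g : Vec n → Vec n → ℝ≥0∞ := fun y w => ‖f y - m w‖ₑ + ‖f (y + v) - m w‖ₑ with hg
  have hgm : Measurable (Function.uncurry g) := by
    have a1 : StronglyMeasurable (fun q : Vec n × Vec n => f q.1 - m q.2) :=
      (hf.comp continuous_fst).stronglyMeasurable.sub (hmm.comp_measurable measurable_snd)
    have a2 : StronglyMeasurable (fun q : Vec n × Vec n => f (q.1 + v) - m q.2) :=
      (Continuous.stronglyMeasurable (by fun_prop)).sub (hmm.comp_measurable measurable_snd)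
    exact a1.enorm.add a2.enorm
  set T : Set (Vec n × Vec n) := {q | q.1 ∈ L ∧ dist q.1 q.2 < s} with hT
  have hTm : MeasurableSet T :=
    (hL.preimage measurable_fst).inter
      (measurableSet_lt (measurable_fst.dist measurable_snd) measurable_const)
  have key1 : (∫⁻ y in L, ‖f y - f (y + v)‖ₑ) * V
      ≤ ∫⁻ y, ∫⁻ w, T.indicator (Function.uncurry g) (y, w) := by
    rw [← lintegral_mul_const' _ _ hVt, ← lintegral_indicator hL]
    refine lintegral_mono fun y => ?_
    by_cases hy : y ∈ L
    · rw [indicator_of_mem hy]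
      have : V = ∫⁻ w, (ball y s).indicator 1 w := by
        rw [lintegral_indicator_one measurableSet_ball, hV, Measure.addHaar_ball_center volume y]
      rw [this, ← lintegral_const_mul' _ _ enorm_ne_top]
      refine lintegral_mono fun w => ?_
      by_cases hw : w ∈ ball y s
      · have : (y, w) ∈ T := ⟨hy, by rw [dist_comm]; exact hw⟩
        rw [indicator_of_mem hw, indicator_of_mem this]
        simp only [Pi.one_apply, mul_one, Function.uncurry_apply_pair, hg]
        rw [enorm_sub_rev (f (y + v))]
        calc ‖f y - f (y + v)‖ₑ = ‖(f y - m w) + (m w - f (y + v))‖ₑ := by congr 1; abel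
          _ ≤ _ := enorm_add_le _ _
      · rw [indicator_of_notMem hw]; simp
    · rw [indicator_of_notMem hy]; exact zero_le
  have key2 : ∫⁻ y, ∫⁻ w, T.indicator (Function.uncurry g) (y, w)
      = ∫⁻ w, ∫⁻ y, T.indicator (Function.uncurry g) (y, w) :=
    lintegral_lintegral_swap (hgm.indicator hTm).aemeasurable
  have key3 : ∀ w, ∫⁻ y, T.indicator (Function.uncurry g) (y, w)
      ≤ (thickening s L).indicator
        (fun _ => 2 * (bmoSeminorm Ω f * volume (ball (0 : Vec n) (2 * s)))) w := by
    intro w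
    by_cases hw : w ∈ thickening s L
    · rw [indicator_of_mem hw]
      have hB := lintegral_sub_average_le_bmoSeminorm f (by positivity) (hΩ w hw)
      rw [Measure.addHaar_ball_center] at hB
      calc ∫⁻ y, T.indicator (Function.uncurry g) (y, w)
          ≤ ∫⁻ y, ((ball w (2 * s)).indicator (fun y => ‖f y - m w‖ₑ) y
            + (ball w (2 * s)).indicator (fun y => ‖f y - m w‖ₑ) (y + v)) := by
            refine lintegral_mono fun y => ?_
            by_cases hy : (y, w) ∈ T
            · have h1 : dist y w < s := hy.2
              have m1 : y ∈ ball w (2 * s) := by rw [mem_ball]; linarith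
              have m2 : y + v ∈ ball w (2 * s) := by
                rw [mem_ball]
                have : dist (y + v) w ≤ dist (y + v) y + dist y w := dist_triangle _ _ _
                simp only [dist_self_add_left] at this
                linarith
              rw [indicator_of_mem hy, indicator_of_mem m1, indicator_of_mem m2]
              rfl
            · rw [indicator_of_notMem hy]; exact zero_le
        _ = (∫⁻ y in ball w (2 * s), ‖f y - m w‖ₑ) + ∫⁻ y in ball w (2 * s), ‖f y - m w‖ₑ := by
            have hmeas : Measurable ((ball w (2 * s)).indicator (fun y => ‖f y - m w‖ₑ)) :=
              (hf.sub continuous_const).enorm.measurable.indicator measurableSet_ball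
            rw [lintegral_add_left hmeas,
              lintegral_add_right_eq_self (μ := (volume : Measure (Vec n)))
                (fun y => (ball w (2 * s)).indicator (fun y => ‖f y - m w‖ₑ) y),
              lintegral_indicator measurableSet_ball]
        _ ≤ _ := (add_le_add hB hB).trans (two_mul _).ge
    · rw [indicator_of_notMem hw]
      refine le_of_eq ?_
      refine (lintegral_congr fun y => ?_).trans lintegral_zero
      refine indicator_of_notMem (fun hy => hw ?_) _
      exact mem_thickening_iff.2 ⟨y, hy.1, by rw [dist_comm]; exact hy.2⟩
  have key4 : (∫⁻ y in L, ‖f y - f (y + v)‖ₑ) * V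
      ≤ (2 ^ (n + 1) * bmoSeminorm Ω f * volume (thickening s L)) * V := by
    refine key1.trans (key2.le.trans ((lintegral_mono key3).trans ?_))
    rw [lintegral_indicator isOpen_thickening.measurableSet, setLIntegral_const,
      volume_ball_mul (0 : Vec n) 0 (two_pos), ← hV]
    simp only [ENNReal.ofReal_ofNat, pow_succ]
    refine le_of_eq ?_
    ring
  exact (ENNReal.mul_le_mul_iff_left hV0 hVt).1 key4

end Oscillation

/-! ### Oscillation near a Lipschitz graph -/

section Graph

variable {n : ℕ} {E : Type*} [NormedAddCommGroup E] [NormedSpace ℝ E]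

/-- `h` measures the height above a Lipschitz graph in the direction `e`. -/
structure IsGraphHeight (h : Vec n → ℝ) (e : Vec n) (Λ : ℝ) : Prop where
  norm_dir : ‖e‖ = 1
  lip : ∀ y z, |h y - h z| ≤ Λ * ‖y - z‖
  add : ∀ y (t : ℝ), h (y + t • e) = h y + t

/-- The part at height in `(α, β]` of the cylinder of direction `e` over the ball `B(x, ρ)`. -/
def graphSlab (h : Vec n → ℝ) (e x : Vec n) (ρ α β : ℝ) : Set (Vec n) :=
  {y | (∃ t : ℝ, y + t • e ∈ ball x ρ) ∧ α < h y ∧ h y ≤ β}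

variable {h : Vec n → ℝ} {e : Vec n} {Λ : ℝ}

namespace IsGraphHeight

lemma one_le (H : IsGraphHeight h e Λ) : 1 ≤ Λ := by
  have h1 := H.lip (0 + (1 : ℝ) • e) 0
  rw [H.add] at h1
  simpa [H.norm_dir] using h1

lemma continuous (H : IsGraphHeight h e Λ) : Continuous h := by
  have : LipschitzWith (Real.toNNReal Λ) h := by
    refine LipschitzWith.of_dist_le_mul fun y z => ?_
    rw [Real.dist_eq, dist_eq_norm, Real.coe_toNNReal _ (by linarith [H.one_le])]
    exact H.lip y z
  exact this.continuous

lemma measurableSet_graphSlab (H : IsGraphHeight h e Λ) (x : Vec n) (ρ α β : ℝ) :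
    MeasurableSet (graphSlab h e x ρ α β) := by
  have h1 : IsOpen {y : Vec n | ∃ t : ℝ, y + t • e ∈ ball x ρ} := by
    have : {y : Vec n | ∃ t : ℝ, y + t • e ∈ ball x ρ}
        = ⋃ t : ℝ, (fun y : Vec n => y + t • e) ⁻¹' ball x ρ := by ext; simp
    rw [this]
    exact isOpen_iUnion fun t => isOpen_ball.preimage (by fun_prop)
  exact h1.measurableSet.inter ((measurableSet_lt measurable_const H.continuous.measurable).inter
    (measurableSet_le H.continuous.measurable measurable_const))

lemma preimage_graphSlab (H : IsGraphHeight h e Λ) (x : Vec n) (ρ α β τ : ℝ) :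
    (fun y => y + τ • e) ⁻¹' graphSlab h e x ρ (α + τ) (β + τ) = graphSlab h e x ρ α β := by
  ext y
  simp only [graphSlab, mem_preimage, mem_ofPred_eq, H.add, add_lt_add_iff_right,
    add_le_add_iff_right, and_congr_left_iff]
  rintro -
  constructor
  · rintro ⟨t, ht⟩
    exact ⟨τ + t, by rwa [add_smul, ← add_assoc]⟩
  · rintro ⟨t, ht⟩
    refine ⟨t - τ, ?_⟩
    convert ht using 1
    module

lemma lintegral_graphSlab_add (H : IsGraphHeight h e Λ) (x : Vec n) (ρ α β τ : ℝ)
    (g : Vec n → ℝ≥0∞) :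
    ∫⁻ y in graphSlab h e x ρ α β, g (y + τ • e)
      = ∫⁻ y in graphSlab h e x ρ (α + τ) (β + τ), g y := by
  rw [← H.preimage_graphSlab x ρ α β τ]
  exact (measurePreserving_add_right (volume : Measure (Vec n)) (τ • e)).setLIntegral_comp_preimage_emb
    (MeasurableEquiv.addRight (τ • e)).measurableEmbedding g _

lemma volume_graphSlab_add (H : IsGraphHeight h e Λ) (x : Vec n) (ρ α β τ : ℝ) :
    volume (graphSlab h e x ρ (α + τ) (β + τ)) = volume (graphSlab h e x ρ α β) := by
  have := H.lintegral_graphSlab_add x ρ α β τ 1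
  simpa using this.symm

lemma lintegral_graphSlab_split (H : IsGraphHeight h e Λ) (x : Vec n) (ρ : ℝ) {α β γ : ℝ}
    (h1 : α ≤ β) (h2 : β ≤ γ) (g : Vec n → ℝ≥0∞) :
    ∫⁻ y in graphSlab h e x ρ α γ, g y
      = (∫⁻ y in graphSlab h e x ρ α β, g y) + ∫⁻ y in graphSlab h e x ρ β γ, g y := by
  rw [← lintegral_union (H.measurableSet_graphSlab x ρ β γ)]
  · congr 2
    ext y
    simp only [graphSlab, mem_ofPred_eq, mem_union]
    constructor
    · rintro ⟨a, b, c⟩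
      rcases le_or_gt (h y) β with d | d
      · exact Or.inl ⟨a, b, d⟩
      · exact Or.inr ⟨a, d, c⟩
    · rintro (⟨a, b, c⟩ | ⟨a, b, c⟩)
      · exact ⟨a, b, c.trans h2⟩
      · exact ⟨a, h1.trans_lt b, c⟩
  · rw [Set.disjoint_left]
    rintro y ⟨_, _, c⟩ ⟨_, d, _⟩
    exact absurd d (not_lt.2 c)

/-- Translation by a along e carries the lower half of the slab onto the upper half. This exact
halving makes the errors near the graph a geometric series. -/
lemma volume_graphSlab_two_mul (H : IsGraphHeight h e Λ) (x : Vec n) (ρ : ℝ) {a : ℝ} (ha : 0 ≤ a) :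
    volume (graphSlab h e x ρ 0 (2 * a)) = 2 * volume (graphSlab h e x ρ 0 a) := by
  have h1 := H.lintegral_graphSlab_split x ρ ha (by linarith : a ≤ 2 * a) 1
  have h2 := H.volume_graphSlab_add x ρ 0 a a
  simp only [zero_add, ← two_mul] at h2
  simp only [Pi.one_apply, lintegral_const, MeasurableSet.univ, Measure.restrict_apply,
    univ_inter, one_mul, h2] at h1
  rw [h1, two_mul]

lemma dist_lt_of_mem_graphSlab (H : IsGraphHeight h e Λ) {x y : Vec n} {ρ α β : ℝ}
    (hy : y ∈ graphSlab h e x ρ α β) (T : ℝ) :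
    ‖y - (x + (T - h x) • e)‖ < ρ + Λ * ρ + |h y - T| := by
  obtain ⟨⟨t, ht⟩, -, -⟩ := hy
  rw [mem_ball, dist_eq_norm] at ht
  have h1 := H.lip (y + t • e) x
  rw [H.add] at h1
  have h2 : Λ * ‖y + t • e - x‖ ≤ Λ * ρ :=
    mul_le_mul_of_nonneg_left ht.le (by linarith [H.one_le])
  have h3 : y - (x + (T - h x) • e) = (y + t • e - x) - (t + T - h x) • e := by module
  rw [h3]
  have h4 := norm_sub_le (y + t • e - x) ((t + T - h x) • e)
  rw [norm_smul, H.norm_dir, mul_one, Real.norm_eq_abs] at h4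
  have h5 : |t + T - h x| ≤ |h y + t - h x| + |h y - T| := by
    have : t + T - h x = (h y + t - h x) - (h y - T) := by ring
    rw [this]; exact abs_sub _ _
  linarith

lemma thickening_graphSlab_subset (H : IsGraphHeight h e Λ) (x : Vec n) (ρ α β s : ℝ) :
    thickening s (graphSlab h e x ρ α β)
      ⊆ graphSlab h e x (ρ + s) (α - Λ * s) (β + Λ * s) := by
  intro w hw
  obtain ⟨y, ⟨⟨t, ht⟩, h1, h2⟩, hwy⟩ := mem_thickening_iff.1 hw
  have h3 := abs_le.1 (H.lip w y)
  rw [dist_eq_norm] at hwy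
  have h4 : Λ * ‖w - y‖ ≤ Λ * s := mul_le_mul_of_nonneg_left hwy.le (by linarith [H.one_le])
  refine ⟨⟨t, ?_⟩, by linarith, by linarith⟩
  rw [mem_ball, dist_eq_norm] at ht ⊢
  have : w + t • e - x = (y + t • e - x) + (w - y) := by module
  rw [this]
  exact (norm_add_le _ _).trans_lt (by linarith)

end IsGraphHeight

lemma graphSlab_mono {x : Vec n} {ρ ρ' α α' β β' : ℝ} (h1 : ρ ≤ ρ') (h2 : α' ≤ α) (h3 : β ≤ β') :
    graphSlab h e x ρ α β ⊆ graphSlab h e x ρ' α' β' := by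
  rintro y ⟨⟨t, ht⟩, a, b⟩
  exact ⟨⟨t, ball_subset_ball h1 ht⟩, h2.trans_lt a, b.trans h3⟩

/-- The configuration at scale `ρ` around a point `x` near the graph: `Ω` contains the points above
the graph at distance less than `4 T` from `x`, where `T = 2 Λ (1 + Λ) ρ`. -/
structure IsNearGraph (Ω : Set (Vec n)) (h : Vec n → ℝ) (e : Vec n) (Λ : ℝ) (x : Vec n)
    (ρ T : ℝ) (m : ℕ) : Prop where
  height : IsGraphHeight h e Λ
  pos : 0 < ρ
  top_eq : T = 2 * Λ * (1 + Λ) * ρ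
  lt_steps : 3 * Λ * (1 + Λ) < m
  base_nonneg : 0 ≤ h x
  base_le : h x ≤ Λ * ρ
  above : ∀ z, ‖z - x‖ < 4 * T → 0 < h z → z ∈ Ω

namespace IsNearGraph

variable {Ω : Set (Vec n)} {x : Vec n} {ρ T : ℝ} {m : ℕ} {f : Vec n → E}

/-- The point of the choice of T is that T/2 = Λ(1+Λ)ρ. Hence m > 3Λ(1+Λ) makes a translation step
of T/(2m) at most ρ/3, and since Λ ≥ 1 it also gives m ≥ 6Λ. -/
lemma bounds (G : IsNearGraph Ω h e Λ x ρ T m) : (1 + Λ) * ρ ≤ T / 2 ∧ 0 < T ∧ (6 : ℝ) < m ∧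
    T / 2 / m ≤ ρ / 3 := by
  have h1 := G.height.one_le
  have hρ := G.pos
  have hm : (6 : ℝ) < m := by nlinarith [G.lt_steps]
  have h2 : T / 2 = Λ * ((1 + Λ) * ρ) := by rw [G.top_eq]; ring
  have h3 : 0 < (1 + Λ) * ρ := by positivity
  refine ⟨by rw [h2]; nlinarith, by nlinarith, hm, ?_⟩
  rw [div_le_iff₀ (by linarith), h2]
  nlinarith [G.lt_steps]

lemma volume_graphSlab_le (G : IsNearGraph Ω h e Λ x ρ T m) {β : ℝ} (hβ : β ≤ 4 * T) :
    volume (graphSlab h e x (2 * ρ) 0 β) ≤ volume (ball x (6 * T)) := by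
  refine measure_mono fun y hy => ?_
  have h1 := G.height.dist_lt_of_mem_graphSlab hy (h x)
  obtain ⟨b1, b2, b3, b4⟩ := G.bounds
  have h2 : |h y - h x| ≤ 4 * T := by
    obtain ⟨-, h3, h4⟩ := hy
    rw [abs_le]; constructor <;> nlinarith [G.base_nonneg, G.base_le, G.pos]
  rw [sub_self, zero_smul, add_zero] at h1
  rw [mem_ball, dist_eq_norm]
  linarith

/-- With step τ = a/m one has 6Λτ ≤ a. Thickening by τ and then taking balls of radius 2τ lowers
heights by at most 3Λτ ≤ a/2, so everything stays above the graph and hence in Ω. The thickened slab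
fits in the cylinder of radius 2ρ and below height 8a. -/
lemma lintegral_shift_le (G : IsNearGraph Ω h e Λ x ρ T m) (hf : Continuous f) {a α β : ℝ}
    (ha : 0 < a) (haT : a ≤ T / 2) (hα : a ≤ α) (hβ : β ≤ 4 * a) :
    ∫⁻ y in graphSlab h e x ρ α β, ‖f y - f (y + (a / m) • e)‖ₑ
      ≤ 2 ^ (n + 1) * bmoSeminorm Ω f * volume (graphSlab h e x (2 * ρ) 0 (8 * a)) := by
  obtain ⟨b1, b2, b3, b4⟩ := G.bounds
  have hΛ := G.height.one_le
  set τ := a / m with hτ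
  have hm0 : (0 : ℝ) < m := by linarith
  have hτ0 : 0 < τ := by positivity
  have hτm : τ * m = a := by rw [hτ]; field_simp
  have hτρ : τ ≤ ρ / 3 := (div_le_div_of_nonneg_right haT hm0.le).trans b4
  have hΛτ : 6 * (Λ * τ) ≤ a := by
    have : 6 * Λ ≤ m := by nlinarith [G.lt_steps]
    calc 6 * (Λ * τ) = τ * (6 * Λ) := by ring
      _ ≤ τ * m := by gcongr
      _ = a := hτm
  have hτa : τ ≤ Λ * τ := by nlinarith
  have hsub := G.height.thickening_graphSlab_subset x ρ α β τ
  refine (_root_.lintegral_shift_le (Ω := Ω) hf (G.height.measurableSet_graphSlab _ _ _ _) hτ0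
    (by rw [norm_smul, G.height.norm_dir, mul_one, Real.norm_of_nonneg hτ0.le]) ?_).trans ?_
  · intro w hw z hz
    obtain h1 := hsub hw
    rw [mem_ball, dist_eq_norm] at hz
    have h2 := abs_le.1 (G.height.lip z w)
    have h3 : Λ * ‖z - w‖ ≤ Λ * (2 * τ) := mul_le_mul_of_nonneg_left hz.le (by linarith)
    have h4 := G.height.dist_lt_of_mem_graphSlab h1 (h x)
    rw [sub_self, zero_smul, add_zero] at h4
    have h5 : |h w - h x| ≤ 2 * T + Λ * τ := by
      rw [abs_le]; constructor <;> nlinarith [G.base_nonneg, G.base_le, G.pos, h1.2.1, h1.2.2]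
    refine G.above z ?_ (by linarith [h1.2.1])
    have h6 : ‖z - x‖ ≤ ‖z - w‖ + ‖w - x‖ := by
      have := norm_add_le (z - w) (w - x); simpa using this
    nlinarith
  · gcongr
    exact hsub.trans (graphSlab_mono (by linarith) (by linarith) (by linarith))

lemma lintegral_shift_iterate_le (G : IsNearGraph Ω h e Λ x ρ T m) (hf : Continuous f) (c : E)
    {a α β : ℝ} (ha : 0 < a) (haT : a ≤ T / 2) (hα : a ≤ α) (i : ℕ)
    (hβ : β + i * (a / m) ≤ 4 * a) :
    ∫⁻ y in graphSlab h e x ρ α β, ‖f y - c‖ₑ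
      ≤ (∫⁻ y in graphSlab h e x ρ (α + i * (a / m)) (β + i * (a / m)), ‖f y - c‖ₑ)
        + i * (2 ^ (n + 1) * bmoSeminorm Ω f * volume (graphSlab h e x (2 * ρ) 0 (8 * a))) := by
  obtain ⟨b1, b2, b3, b4⟩ := G.bounds
  have hτ0 : 0 < a / m := div_pos ha (by linarith)
  induction i with
  | zero => simp
  | succ i ih =>
    push_cast at hβ ⊢
    refine (ih (by linarith)).trans ?_
    set X := 2 ^ (n + 1) * bmoSeminorm Ω f * volume (graphSlab h e x (2 * ρ) 0 (8 * a))
    have hi : 0 ≤ (i : ℝ) * (a / m) := by positivity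
    have step := G.lintegral_shift_le (f := f) (α := α + i * (a / m)) (β := β + i * (a / m))
      hf ha haT (by linarith) (by linarith)
    have h1 : ∫⁻ y in graphSlab h e x ρ (α + i * (a / m)) (β + i * (a / m)), ‖f y - c‖ₑ
        ≤ X + ∫⁻ y in graphSlab h e x ρ (α + (i + 1) * (a / m)) (β + (i + 1) * (a / m)),
          ‖f y - c‖ₑ := by
      have e1 : ∀ t : ℝ, t + (i + 1) * (a / m) = (t + i * (a / m)) + a / m := fun t => by ring
      rw [e1, e1, ← G.height.lintegral_graphSlab_add x ρ (α + i * (a / m)) (β + i * (a / m)) (a / m)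
          (fun y => ‖f y - c‖ₑ)]
      refine le_trans ?_ (add_le_add_left step _)
      rw [← lintegral_add_left (by
        exact (Continuous.enorm (by fun_prop)).measurable)]
      refine lintegral_mono fun y => ?_
      calc ‖f y - c‖ₑ = ‖(f y - f (y + (a / m) • e)) + (f (y + (a / m) • e) - c)‖ₑ := by
            congr 1; abel
        _ ≤ _ := enorm_add_le _ _
    calc _ ≤ _ := add_le_add_left h1 _
      _ = _ := by ring

/-- Translations by a and by 2a carry the layer (a, 2a] onto the two halves (2a, 3a] and (3a, 4a] of
the next dyadic layer. Adding the two comparisons produces the factor 2 on the left, which makes the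
layer integrals decay geometrically towards the graph. The number of steps is m + 2m = 3m. -/
lemma two_mul_lintegral_layer_le (G : IsNearGraph Ω h e Λ x ρ T m) (hf : Continuous f) (c : E)
    {a : ℝ} (ha : 0 < a) (haT : a ≤ T / 2) :
    2 * ∫⁻ y in graphSlab h e x ρ a (2 * a), ‖f y - c‖ₑ
      ≤ (∫⁻ y in graphSlab h e x ρ (2 * a) (4 * a), ‖f y - c‖ₑ)
        + 3 * m * (2 ^ (n + 1) * bmoSeminorm Ω f *
          volume (graphSlab h e x (2 * ρ) 0 (8 * a))) := by
  obtain ⟨b1, b2, b3, b4⟩ := G.bounds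
  have hm0 : (m : ℝ) ≠ 0 := by linarith
  have e1 : (m : ℝ) * (a / m) = a := by field_simp
  have e2 : ((2 * m : ℕ) : ℝ) * (a / m) = 2 * a := by push_cast; field_simp
  have h1 := G.lintegral_shift_iterate_le (f := f) hf c (β := 2 * a) ha haT le_rfl m
    (by rw [e1]; linarith)
  have h2 := G.lintegral_shift_iterate_le (f := f) hf c (β := 2 * a) ha haT le_rfl (2 * m)
    (by rw [e2]; linarith)
  rw [e1] at h1
  rw [e2] at h2
  rw [G.height.lintegral_graphSlab_split x ρ (by linarith : 2 * a ≤ 3 * a)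
    (by linarith : 3 * a ≤ 4 * a)]
  have r1 : a + a = 2 * a := by ring
  have r2 : 2 * a + a = 3 * a := by ring
  have r3 : a + 2 * a = 3 * a := by ring
  have r4 : 2 * a + 2 * a = 4 * a := by ring
  rw [r1, r2] at h1
  rw [r3, r4] at h2
  rw [two_mul]
  refine (add_le_add h1 h2).trans (le_of_eq ?_)
  push_cast
  ring

/-- The layer is cut into m slices of thickness a/m, and each is pushed up to the same slice just
above height 2a in at most m steps. For a = T/2 that single slice is thin enough to lie in one ball
inside Ω. -/
lemma lintegral_layer_le (G : IsNearGraph Ω h e Λ x ρ T m) (hf : Continuous f) (c : E)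
    {a : ℝ} (ha : 0 < a) (haT : a ≤ T / 2) :
    ∫⁻ y in graphSlab h e x ρ a (2 * a), ‖f y - c‖ₑ
      ≤ m * ((∫⁻ y in graphSlab h e x ρ (2 * a) (2 * a + a / m), ‖f y - c‖ₑ)
        + m * (2 ^ (n + 1) * bmoSeminorm Ω f *
          volume (graphSlab h e x (2 * ρ) 0 (8 * a)))) := by
  obtain ⟨b1, b2, b3, b4⟩ := G.bounds
  have hm0 : (0 : ℝ) < m := by linarith
  have e1 : (m : ℝ) * (a / m) = a := by field_simp
  have hτ0 : 0 < a / m := div_pos ha hm0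
  have hτa : a / m ≤ a := div_le_self ha.le (by linarith)
  set X := 2 ^ (n + 1) * bmoSeminorm Ω f * volume (graphSlab h e x (2 * ρ) 0 (8 * a))
  set Y := ∫⁻ y in graphSlab h e x ρ (2 * a) (2 * a + a / m), ‖f y - c‖ₑ
  have key : ∀ j : ℕ, j ≤ m → ∫⁻ y in graphSlab h e x ρ a (a + j * (a / m)), ‖f y - c‖ₑ
      ≤ j * (Y + m * X) := by
    intro j
    induction j with
    | zero =>
      intro _
      have : graphSlab h e x ρ a (a + (0 : ℕ) * (a / m)) = ∅ := by
        ext y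
        simp only [graphSlab, Nat.cast_zero, zero_mul, add_zero, mem_ofPred_eq, mem_empty_iff_false,
          iff_false]
        rintro ⟨_, h1, h2⟩
        linarith
      rw [this]; simp
    | succ j ih =>
      intro hj
      have hj0 : 0 ≤ (j : ℝ) * (a / m) := by positivity
      push_cast
      have hjm : ((m - j : ℕ) : ℝ) = m - j := by
        rw [Nat.cast_sub (by omega)]
      have E1 : a + j * (a / m) + ((m - j : ℕ) : ℝ) * (a / m) = 2 * a := by
        rw [hjm]; linarith
      have E2 : a + (j + 1) * (a / m) + ((m - j : ℕ) : ℝ) * (a / m) = 2 * a + a / m := by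
        rw [hjm]; linarith
      have sh := G.lintegral_shift_iterate_le (f := f) hf c (α := a + j * (a / m))
        (β := a + (j + 1) * (a / m)) ha haT (by linarith) (m - j) (by rw [E2]; linarith)
      rw [E1, E2] at sh
      rw [G.height.lintegral_graphSlab_split x ρ (by linarith : a ≤ a + j * (a / m))
        (by linarith), add_mul (j : ℝ≥0∞), one_mul (Y + m * X)]
      refine add_le_add (ih (by omega)) (sh.trans ?_)
      gcongr
      omega
  have := key m le_rfl
  rwa [e1, ← two_mul] at this

/-- The slab is the union of the dyadic layers (T/2^(k+1), T/2^k], with integrals J k satisfying 2 J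
(k+1) ≤ J k plus an error proportional to W k. Since W k halves at each step, summing the recursion
bounds everything by the top layer. -/
lemma lintegral_graphSlab_le (G : IsNearGraph Ω h e Λ x ρ T m) (hf : Continuous f) (c : E) :
    ∫⁻ y in graphSlab h e x ρ 0 T, ‖f y - c‖ₑ
      ≤ 2 * (∫⁻ y in graphSlab h e x ρ (T / 2) T, ‖f y - c‖ₑ)
        + 3 * m * (2 ^ (n + 1) * bmoSeminorm Ω f *
          (2 * volume (graphSlab h e x (2 * ρ) 0 (2 * T)))) := by
  obtain ⟨b1, b2, b3, b4⟩ := G.bounds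
  set J : ℕ → ℝ≥0∞ := fun k => ∫⁻ y in graphSlab h e x ρ (T / 2 ^ (k + 1)) (T / 2 ^ k), ‖f y - c‖ₑ
    with hJ
  set W : ℕ → ℝ≥0∞ := fun k => volume (graphSlab h e x (2 * ρ) 0 (2 * T / 2 ^ k)) with hW
  have hWs : ∀ k, W k = 2 * W (k + 1) := by
    intro k
    simp only [hW]
    rw [← G.height.volume_graphSlab_two_mul _ _ (by positivity), pow_succ]
    congr 2
    field_simp
  have hJs : ∀ k, 2 * J (k + 1) ≤ J k + 3 * m * (2 ^ (n + 1) * bmoSeminorm Ω f * W k) := by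
    intro k
    have hp : (1 : ℝ) ≤ 2 ^ k := one_le_pow₀ (by norm_num)
    have := G.two_mul_lintegral_layer_le (f := f) hf c (a := T / 2 ^ (k + 2)) (by positivity) (by
      rw [pow_add, div_le_div_iff₀ (by positivity) (by positivity)]
      nlinarith)
    have q1 : 2 * (T / 2 ^ (k + 2)) = T / 2 ^ (k + 1) := by rw [pow_succ _ (k + 1)]; field_simp
    have q2 : 4 * (T / 2 ^ (k + 2)) = T / 2 ^ k := by rw [pow_add]; field_simp; norm_num
    have q3 : 8 * (T / 2 ^ (k + 2)) = 2 * T / 2 ^ k := by rw [pow_add]; field_simp; norm_num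
    rw [q1, q2, q3] at this
    exact this
  have hWsum : ∀ N, ∑ k ∈ Finset.range N, W k + 2 * W N = 2 * W 0 := by
    intro N
    induction N with
    | zero => simp
    | succ N ih => rw [Finset.sum_range_succ, ← hWs, ← ih, two_mul, add_assoc]
  -- The spare `J N` makes the induction close: the two copies of `J (N + 1)` are replaced by one
  -- copy of `J N` plus an error.
  have hJsum : ∀ N, ∑ k ∈ Finset.range (N + 1), J k + J N
      ≤ 2 * J 0 + 3 * m * (2 ^ (n + 1) * bmoSeminorm Ω f * ∑ k ∈ Finset.range N, W k) := by
    intro N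
    induction N with
    | zero => simp [two_mul]
    | succ N ih =>
      rw [Finset.sum_range_succ, add_assoc, ← two_mul, Finset.sum_range_succ W N]
      refine (add_le_add_right (hJs N) _).trans ?_
      rw [← add_assoc]
      refine (add_le_add_left ih _).trans (le_of_eq ?_)
      ring
  have hcov : graphSlab h e x ρ 0 T ⊆ ⋃ k : ℕ, graphSlab h e x ρ (T / 2 ^ (k + 1)) (T / 2 ^ k) := by
    rintro y ⟨ht, h1, h2⟩
    have hlim : Tendsto (fun k : ℕ => T / 2 ^ k) atTop (𝓝 0) := by
      have := (tendsto_pow_atTop_nhds_zero_of_lt_one (r := (1 / 2 : ℝ)) (by norm_num)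
        (by norm_num)).const_mul T
      simpa [div_eq_mul_inv] using this
    obtain ⟨k, hk⟩ := (hlim.eventually (gt_mem_nhds h1)).exists
    classical
    have hex : ∃ k : ℕ, T / 2 ^ k < h y := ⟨k, hk⟩
    have hs := Nat.find_spec hex
    have h0 : Nat.find hex ≠ 0 := by
      intro h0
      rw [h0] at hs
      simp at hs
      linarith
    obtain ⟨j, hj⟩ := Nat.exists_eq_succ_of_ne_zero h0
    have hmin := Nat.find_min hex (m := j) (by omega)
    rw [hj] at hs
    exact mem_iUnion.2 ⟨j, ht, hs, not_lt.1 hmin⟩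
  have hJ0 : J 0 = ∫⁻ y in graphSlab h e x ρ (T / 2) T, ‖f y - c‖ₑ := by simp [hJ]
  have hW0 : W 0 = volume (graphSlab h e x (2 * ρ) 0 (2 * T)) := by simp [hW]
  rw [← hJ0, ← hW0]
  calc _ ≤ ∫⁻ y in ⋃ k : ℕ, graphSlab h e x ρ (T / 2 ^ (k + 1)) (T / 2 ^ k), ‖f y - c‖ₑ :=
        lintegral_mono_set hcov
    _ ≤ ∑' k, J k := lintegral_iUnion_le _ _
    _ ≤ _ := by
        refine ENNReal.tsum_le_of_sum_range_le fun N => ?_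
        calc ∑ k ∈ Finset.range N, J k ≤ ∑ k ∈ Finset.range (N + 1), J k + J N := by
              rw [Finset.sum_range_succ, add_assoc]; exact le_self_add
          _ ≤ _ := hJsum N
          _ ≤ _ := by
              gcongr
              rw [← hWsum N]
              exact le_self_add

/-- The comparison constant is the mean of f on a ball centred at the point z₀ of height T on the
line through x in direction e. The ball contains the thin slice above height T, and Λr < T keeps it
above the graph. The whole of B(x, ρ) ∩ Ω lies in the slab of heights (0, T], which is compared with
this slice. -/
lemma exists_lintegral_ball_le (G : IsNearGraph Ω h e Λ x ρ T m) (hf : Continuous f)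
    (hΩ : ∀ z ∈ Ω, ‖z - x‖ < 4 * T → 0 < h z) :
    ∃ c : E, ∫⁻ y in ball x ρ ∩ Ω, ‖f y - c‖ₑ
      ≤ (2 * m * (1 + m * 2 ^ (n + 1)) + 6 * m * 2 ^ (n + 1)) * bmoSeminorm Ω f *
        volume (ball x (6 * T)) := by
  obtain ⟨b1, b2, b3, b4⟩ := G.bounds
  have hΛ := G.height.one_le
  have hρ := G.pos
  have hm0 : (0 : ℝ) < m := by linarith
  set z₀ := x + (T - h x) • e with hz₀
  set τ := T / 2 / m with hτ
  have hτ0 : 0 < τ := by positivity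
  set r := ρ + Λ * ρ + τ with hr
  have hr0 : 0 < r := by positivity
  have hΛτ : 6 * (Λ * τ) ≤ T / 2 := by
    have h6 : 6 * Λ ≤ m := by nlinarith [G.lt_steps]
    calc 6 * (Λ * τ) = τ * (6 * Λ) := by ring
      _ ≤ τ * m := by gcongr
      _ = T / 2 := by rw [hτ]; field_simp
  have hτΛ : τ ≤ Λ * τ := by nlinarith
  have hrT : r ≤ T := by rw [hr]; linarith
  have hΛr : Λ * r < T := by
    have : Λ * r = T / 2 + Λ * τ := by rw [hr, G.top_eq]; ring
    linarith
  have hzx : ‖z₀ - x‖ ≤ T := by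
    rw [hz₀, add_sub_cancel_left, norm_smul, G.height.norm_dir, mul_one, Real.norm_eq_abs, abs_le]
    constructor <;> nlinarith [G.base_nonneg, G.base_le]
  have hball : ball z₀ r ⊆ Ω := by
    intro z hz
    rw [mem_ball, dist_eq_norm] at hz
    refine G.above z ?_ ?_
    · have : ‖z - x‖ ≤ ‖z - z₀‖ + ‖z₀ - x‖ := by
        have := norm_add_le (z - z₀) (z₀ - x); simpa using this
      linarith
    · have h1 := abs_le.1 (G.height.lip z z₀)
      have h2 : h z₀ = T := by rw [hz₀, G.height.add]; ring
      have h3 : Λ * ‖z - z₀‖ ≤ Λ * r := mul_le_mul_of_nonneg_left hz.le (by linarith)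
      linarith
  refine ⟨⨍ w in ball z₀ r, f w, ?_⟩
  set c := ⨍ w in ball z₀ r, f w
  set b := bmoSeminorm Ω f
  set V := volume (ball x (6 * T))
  have s1 : ∫⁻ y in graphSlab h e x ρ T (T + τ), ‖f y - c‖ₑ ≤ b * V := by
    calc _ ≤ ∫⁻ y in ball z₀ r, ‖f y - c‖ₑ := by
          refine lintegral_mono_set fun y hy => ?_
          have := G.height.dist_lt_of_mem_graphSlab hy T
          rw [mem_ball, dist_eq_norm]
          have h2 : |h y - T| ≤ τ := by
            rw [abs_le]; constructor <;> linarith [hy.2.1, hy.2.2]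
          linarith
      _ ≤ b * volume (ball z₀ r) := lintegral_sub_average_le_bmoSeminorm f hr0 hball
      _ ≤ b * V := by
          gcongr
          rw [Measure.addHaar_ball_center, ← Measure.addHaar_ball_center volume x]
          exact measure_mono (ball_subset_ball (by linarith))
  have s2 := G.lintegral_layer_le (f := f) hf c (a := T / 2) (by positivity) le_rfl
  have e1 : 2 * (T / 2) = T := by ring
  have e2 : 8 * (T / 2) = 4 * T := by ring
  rw [e1, e2] at s2
  have v1 := G.volume_graphSlab_le (β := 4 * T) le_rfl
  have v2 := G.volume_graphSlab_le (β := 2 * T) (by linarith)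
  calc ∫⁻ y in ball x ρ ∩ Ω, ‖f y - c‖ₑ ≤ ∫⁻ y in graphSlab h e x ρ 0 T, ‖f y - c‖ₑ := by
        refine lintegral_mono_set fun y hy => ⟨⟨0, by simpa using hy.1⟩, ?_, ?_⟩
        · have := hy.1
          rw [mem_ball, dist_eq_norm] at this
          exact hΩ y hy.2 (by nlinarith)
        · have := hy.1
          rw [mem_ball, dist_eq_norm] at this
          have h1 := abs_le.1 (G.height.lip y x)
          have h3 : Λ * ‖y - x‖ ≤ Λ * ρ := mul_le_mul_of_nonneg_left this.le (by linarith)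
          nlinarith [G.base_le]
    _ ≤ _ := G.lintegral_graphSlab_le hf c
    _ ≤ 2 * (m * (b * V + m * (2 ^ (n + 1) * b * V))) + 3 * m * (2 ^ (n + 1) * b * (2 * V)) := by
        gcongr
        refine s2.trans ?_
        gcongr
    _ = _ := by ring

end IsNearGraph

end Graph

/-! ### From local graphs to uniform and global oscillation bounds -/

section OscillationBound

variable {n : ℕ}

/-- `Ω` fills a fixed proportion of `B(x, ρ)`, and the mean oscillation over `B(x, ρ) ∩ Ω` is
controlled by the one over the balls contained in `Ω`. -/
structure HasOscillationBound (E : Type*) [NormedAddCommGroup E] [NormedSpace ℝ E]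
    (Ω : Set (Vec n)) (A : NNReal) (x : Vec n) (ρ : ℝ) : Prop where
  volume_le : volume (ball x ρ) ≤ A * volume (ball x ρ ∩ Ω)
  osc : ∀ f : Vec n → E, Continuous f → ∃ c : E,
    ∫⁻ y in ball x ρ ∩ Ω, ‖f y - c‖ₑ ≤ A * bmoSeminorm Ω f * volume (ball x ρ)

variable {E : Type*} [NormedAddCommGroup E] [NormedSpace ℝ E] {Ω : Set (Vec n)}

lemma HasOscillationBound.mono {A B : NNReal} {x : Vec n} {ρ : ℝ}
    (H : HasOscillationBound E Ω A x ρ) (hAB : A ≤ B) : HasOscillationBound E Ω B x ρ where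
  volume_le := H.volume_le.trans (by gcongr)
  osc f hf := by
    obtain ⟨c, hc⟩ := H.osc f hf
    exact ⟨c, hc.trans (by gcongr)⟩

lemma hasOscillationBound_of_ball_subset {x : Vec n} {ρ : ℝ} (hρ : 0 < ρ) (h : ball x ρ ⊆ Ω) :
    HasOscillationBound E Ω 1 x ρ where
  volume_le := by rw [inter_eq_left.2 h]; simp
  osc f _ := by
    rw [inter_eq_left.2 h]
    exact ⟨_, by simpa using lintegral_sub_average_le_bmoSeminorm f hρ h⟩

/-- The 2 in the constant 1 + 2K is the crude triangle-inequality bound for the projection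
orthogonal to e. -/
lemma isGraphHeight_of_lipschitzWith {e : Vec n} (he : ‖e‖ = 1) {K : NNReal} {ψ : Vec n → ℝ}
    (hψ : LipschitzWith K ψ) :
    IsGraphHeight (fun y => inner ℝ e y - ψ (y - inner ℝ e y • e)) e (1 + 2 * K) where
  norm_dir := he
  lip y z := by
    have h1 : |inner ℝ e y - inner ℝ e z| ≤ ‖y - z‖ := by
      rw [← inner_sub_right]
      simpa [he] using abs_real_inner_le_norm e (y - z)
    have h2 := hψ.dist_le_mul (y - inner ℝ e y • e) (z - inner ℝ e z • e)
    rw [Real.dist_eq, dist_eq_norm] at h2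
    have h3 : ‖y - inner ℝ e y • e - (z - inner ℝ e z • e)‖ ≤ 2 * ‖y - z‖ := by
      have : y - inner ℝ e y • e - (z - inner ℝ e z • e)
          = (y - z) - (inner ℝ e y - inner ℝ e z) • e := by module
      rw [this]
      refine (norm_sub_le _ _).trans ?_
      rw [norm_smul, he, mul_one, Real.norm_eq_abs]
      linarith
    have h4 := mul_le_mul_of_nonneg_left h3 K.2
    rw [NNReal.val_eq_coe] at h4
    have h5 : inner ℝ e y - ψ (y - inner ℝ e y • e) - (inner ℝ e z - ψ (z - inner ℝ e z • e))
      = (inner ℝ e y - inner ℝ e z)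
        - (ψ (y - inner ℝ e y • e) - ψ (z - inner ℝ e z • e)) := by ring
    rw [h5]
    refine (abs_sub _ _).trans ?_
    linarith
  add y t := by
    have h1 : inner ℝ e (y + t • e) = inner ℝ e y + t := by
      rw [inner_add_right, inner_smul_right, real_inner_self_eq_norm_sq, he]; simp
    have h2 : y + t • e - inner ℝ e (y + t • e) • e = y - inner ℝ e y • e := by
      rw [h1]; module
    rw [h2, h1]; ring

lemma exists_hasOscillationBound_of_graph {h : Vec n → ℝ} {e : Vec n} {Λ : ℝ}
    (H : IsGraphHeight h e Λ) {x₀ : Vec n} {R : ℝ} (hR : 0 < R)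
    (hΩ : ∀ z ∈ ball x₀ R, (z ∈ Ω ↔ 0 < h z)) :
    ∃ r > 0, ∃ A : NNReal, ∀ x ∈ ball x₀ r ∩ Ω, ∀ ρ, 0 < ρ → ρ ≤ r →
      HasOscillationBound E Ω A x ρ := by
  have hΛ := H.one_le
  obtain ⟨m, hm⟩ := exists_nat_gt (3 * Λ * (1 + Λ))
  set k : ℝ := 12 * Λ * (1 + Λ) with hk
  have hk0 : 0 < k := by positivity
  set B : NNReal := (2 * m * (1 + m * 2 ^ (n + 1)) + 6 * m * 2 ^ (n + 1)) * Real.toNNReal k ^ n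
  -- The radius gives 4T < R/2 and |x - x₀| ≤ R/2, so B(x, 4T) stays where the graph describes Ω.
  -- The three constants serve balls inside Ω, the volume bound and the oscillation bound.
  refine ⟨R / (16 * Λ * (1 + Λ) + 2), by positivity, max 1 (max (Real.toNNReal (2 * Λ) ^ n) B), ?_⟩
  rintro x ⟨hx, hxΩ⟩ ρ hρ hρr
  rw [le_div_iff₀ (by positivity)] at hρr
  rw [mem_ball, dist_eq_norm, lt_div_iff₀ (by positivity)] at hx
  set T := 2 * Λ * (1 + Λ) * ρ with hT
  have hTpos : 0 < T := by positivity
  have hTR : 4 * T < R / 2 := by rw [hT]; nlinarith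
  have hxR : ‖x - x₀‖ ≤ R / 2 := by
    have : 0 ≤ ‖x - x₀‖ * (16 * Λ * (1 + Λ)) := by positivity
    linarith
  have hin : ∀ z, ‖z - x‖ < 4 * T → z ∈ ball x₀ R := by
    intro z hz
    rw [mem_ball, dist_eq_norm]
    have := norm_add_le (z - x) (x - x₀)
    rw [sub_add_sub_cancel] at this
    linarith
  have hhx : 0 < h x := (hΩ x (hin x (by simp; positivity))).1 hxΩ
  have hρT : ρ ≤ T := by
    have : 1 ≤ 2 * Λ * (1 + Λ) := by nlinarith
    rw [hT]; nlinarith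
  -- At height at least Λρ the ball cannot reach the graph, so it lies in Ω; only lower centres need
  -- the slab argument.
  by_cases hc : Λ * ρ ≤ h x
  · refine (hasOscillationBound_of_ball_subset hρ fun z hz => ?_).mono (le_max_left _ _)
    rw [mem_ball, dist_eq_norm] at hz
    refine (hΩ z (hin z (by linarith))).2 ?_
    have h1 := abs_le.1 (H.lip z x)
    have : Λ * ‖z - x‖ < Λ * ρ := mul_lt_mul_of_pos_left hz (by linarith)
    linarith
  push Not at hc
  have G : IsNearGraph Ω h e Λ x ρ T m :=
    ⟨H, hρ, hT, hm, hhx.le, hc.le, fun z hz hz' => (hΩ z (hin z hz)).2 hz'⟩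
  refine ⟨?_, fun f hf => ?_⟩
  -- Moving up by ρ/2 leaves room for a ball of radius ρ/(2Λ) above the graph and within B(x, ρ).
  · have hsub : ball (x + (ρ / 2) • e) (ρ / (2 * Λ)) ⊆ ball x ρ ∩ Ω := by
      intro z hz
      rw [mem_ball, dist_eq_norm] at hz
      have h1 : ρ / (2 * Λ) ≤ ρ / 2 := div_le_div_of_nonneg_left hρ.le (by norm_num) (by linarith)
      have h2 : ‖z - x‖ < ρ := by
        have : z - x = (z - (x + (ρ / 2) • e)) + (ρ / 2) • e := by module
        rw [this]
        refine (norm_add_le _ _).trans_lt ?_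
        rw [norm_smul, H.norm_dir, mul_one, Real.norm_of_nonneg (by positivity)]
        linarith
      refine ⟨by rwa [mem_ball, dist_eq_norm], (hΩ z (hin z (by linarith))).2 ?_⟩
      have h3 := abs_le.1 (H.lip z (x + (ρ / 2) • e))
      rw [H.add] at h3
      have h4 : Λ * ‖z - (x + (ρ / 2) • e)‖ ≤ Λ * (ρ / (2 * Λ)) :=
        mul_le_mul_of_nonneg_left hz.le (by linarith)
      have h5 : Λ * (ρ / (2 * Λ)) = ρ / 2 := by field_simp
      linarith
    have hv : volume (ball x ρ)
        = ENNReal.ofReal (2 * Λ) ^ n * volume (ball (x + (ρ / 2) • e) (ρ / (2 * Λ))) := by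
      rw [← volume_ball_mul x _ (by positivity)]
      congr 2
      field_simp
    rw [hv]
    gcongr
    push_cast
    exact le_max_of_le_right (le_max_of_le_left le_rfl)
  · obtain ⟨c, hc⟩ := G.exists_lintegral_ball_le hf
      (fun z hz hz' => (hΩ z (hin z hz')).1 hz)
    refine ⟨c, hc.trans ?_⟩
    have hv : volume (ball x (6 * T)) = ENNReal.ofReal k ^ n * volume (ball x ρ) := by
      rw [← volume_ball_mul x _ hk0]
      congr 2
      rw [hT, hk]; ring
    rw [hv]
    calc _ = (B : ℝ≥0∞) * bmoSeminorm Ω f * volume (ball x ρ) := by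
          simp only [B]
          push_cast
          rw [ENNReal.ofReal]
          ring
      _ ≤ _ := by
          gcongr
          exact le_max_of_le_right (le_max_right _ _)

lemma IsLipschitzDomain.exists_hasOscillationBound (hΩ : IsLipschitzDomain Ω) :
    ∃ r > 0, ∃ A : NNReal, ∀ x ∈ Ω, ∀ ρ, 0 < ρ → ρ ≤ r → HasOscillationBound E Ω A x ρ := by
  have hK : IsCompact (closure Ω) := hΩ.bounded.isCompact_closure
  have key := hK.induction_on (p := fun s => ∃ r > 0, ∃ A : NNReal, ∀ x ∈ s ∩ Ω, ∀ ρ, 0 < ρ →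
    ρ ≤ r → HasOscillationBound E Ω A x ρ) ⟨1, one_pos, 0, by simp⟩ ?_ ?_ ?_
  · obtain ⟨r, hr, A, h⟩ := key
    exact ⟨r, hr, A, fun x hx => h x ⟨subset_closure hx, hx⟩⟩
  · rintro s t hst ⟨r, hr, A, h⟩
    exact ⟨r, hr, A, fun x hx => h x ⟨hst hx.1, hx.2⟩⟩
  · rintro s t ⟨r, hr, A, h⟩ ⟨r', hr', A', h'⟩
    refine ⟨min r r', lt_min hr hr', max A A', ?_⟩
    rintro x ⟨hx | hx, hxΩ⟩ ρ hρ hρr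
    · exact (h x ⟨hx, hxΩ⟩ ρ hρ (hρr.trans (min_le_left _ _))).mono (le_max_left _ _)
    · exact (h' x ⟨hx, hxΩ⟩ ρ hρ (hρr.trans (min_le_right _ _))).mono (le_max_right _ _)
  · intro x₀ hx₀
    by_cases hx : x₀ ∈ Ω
    · obtain ⟨R, hR, hsub⟩ := Metric.isOpen_iff.1 hΩ.isOpen x₀ hx
      refine ⟨ball x₀ (R / 2), mem_nhdsWithin_of_mem_nhds (ball_mem_nhds _ (by positivity)),
        R / 2, by positivity, 1, fun x hx ρ hρ hρR => ?_⟩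
      refine hasOscillationBound_of_ball_subset hρ ((ball_subset_ball' ?_).trans hsub)
      linarith [mem_ball.1 hx.1]
    · have hfr : x₀ ∈ frontier Ω := by
        rw [hΩ.isOpen.frontier_eq]; exact ⟨hx₀, hx⟩
      obtain ⟨e, R, K, ψ, he, hR, hψ, hgr⟩ := hΩ.graph x₀ hfr
      obtain ⟨r, hr, A, h⟩ := exists_hasOscillationBound_of_graph (E := E) (Ω := Ω)
        (isGraphHeight_of_lipschitzWith he hψ) hR (fun z hz => by rw [hgr z hz, sub_pos])
      exact ⟨ball x₀ r, mem_nhdsWithin_of_mem_nhds (ball_mem_nhds _ hr), r, hr, A, h⟩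

/-- At one fixed scale r, f is close in mean to a constant on each B(x, r) ∩ Ω. Connectedness links
these constants and a finite cover reduces to a single one, which is small because f has mean zero.
-/
lemma IsLipschitzDomain.exists_lintegral_le_bmoSeminorm [CompleteSpace E]
    (hΩ : IsLipschitzDomain Ω) :
    ∃ C : NNReal, ∀ f : Vec n → E, Continuous f → HasCompactSupport f → ∫ x in Ω, f x = 0 →
      ∫⁻ x in Ω, ‖f x‖ₑ ≤ C * bmoSeminorm Ω f := by
  obtain ⟨r, hr, A, hA⟩ := hΩ.exists_hasOscillationBound (E := E)
  have hfin : volume Ω ≠ ⊤ := hΩ.bounded.measure_lt_top.ne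
  have h1 : ∀ (x : Ω) (f : Vec n → E), ∃ c : E, Continuous f →
      ∫⁻ y in ball (x : Vec n) r ∩ Ω, ‖f y - c‖ₑ
        ≤ A * bmoSeminorm Ω f * volume (ball (0 : Vec n) r) := by
    intro x f
    by_cases hf : Continuous f
    · obtain ⟨c, hc⟩ := (hA x x.2 r hr le_rfl).osc f hf
      rw [Measure.addHaar_ball_center] at hc
      exact ⟨c, fun _ => hc⟩
    · exact ⟨0, fun h => absurd h hf⟩
  choose c hc using h1
  set V := volume (ball (0 : Vec n) r) with hV
  have hVt : V ≠ ⊤ := measure_ball_lt_top.ne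
  -- the constants belonging to any two centres are comparable, by connectedness
  have hrel : ∀ x y : Ω, ∃ C : NNReal, ∀ f : Vec n → E, Continuous f →
      ‖c x f - c y f‖ₑ ≤ C * bmoSeminorm Ω f := by
    have : PreconnectedSpace Ω := isPreconnected_iff_preconnectedSpace.1 hΩ.connected.isPreconnected
    intro x₁ y₁
    refine (isPreconnected_univ (α := Ω)).induction₂ (fun x y => ∃ C : NNReal,
      ∀ f : Vec n → E, Continuous f → ‖c x f - c y f‖ₑ ≤ C * bmoSeminorm Ω f) ?_ ?_ ?_
      (mem_univ x₁) (mem_univ y₁)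
    · intro x _
      filter_upwards [mem_nhdsWithin_of_mem_nhds (ball_mem_nhds x hr)] with y hy
      -- On this nonempty open overlap f is close in mean to both constants, so they are close to
      -- each other.
      set U := ball (x : Vec n) r ∩ ball (y : Vec n) r ∩ Ω
      have hU0 : volume U ≠ 0 :=
        (((isOpen_ball.inter isOpen_ball).inter hΩ.isOpen).measure_pos volume
          ⟨x, ⟨mem_ball_self hr, by rw [mem_ball, dist_comm]; exact hy⟩, x.2⟩).ne'
      have hUt : volume U ≠ ⊤ := ne_top_of_le_ne_top hfin (measure_mono inter_subset_right)
      set C : ℝ≥0∞ := 2 * A * V / volume U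
      have hC : C ≠ ⊤ := ENNReal.div_ne_top (by finiteness) hU0
      refine ⟨C.toNNReal, fun f hf => ?_⟩
      rw [ENNReal.coe_toNNReal hC]
      have e1 : ‖c x f - c y f‖ₑ * volume U ≤ 2 * A * V * bmoSeminorm Ω f := by
        calc ‖c x f - c y f‖ₑ * volume U = ∫⁻ z in U, ‖c x f - c y f‖ₑ := by
              rw [setLIntegral_const]
          _ ≤ ∫⁻ z in U, (‖f z - c x f‖ₑ + ‖f z - c y f‖ₑ) := by
              refine lintegral_mono fun z => ?_
              rw [enorm_sub_rev (f z) (c x f)]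
              calc ‖c x f - c y f‖ₑ = ‖(c x f - f z) + (f z - c y f)‖ₑ := by congr 1; abel
                _ ≤ _ := enorm_add_le _ _
          _ = (∫⁻ z in U, ‖f z - c x f‖ₑ) + ∫⁻ z in U, ‖f z - c y f‖ₑ :=
              lintegral_add_left (hf.sub continuous_const).enorm.measurable _
          _ ≤ A * bmoSeminorm Ω f * V + A * bmoSeminorm Ω f * V := by
              refine add_le_add ((lintegral_mono_set ?_).trans (hc x f hf))
                ((lintegral_mono_set ?_).trans (hc y f hf))
              · exact fun z hz => ⟨hz.1.1, hz.2⟩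
              · exact fun z hz => ⟨hz.1.2, hz.2⟩
          _ = _ := by ring
      rw [← ENNReal.le_div_iff_mul_le (Or.inl hU0) (Or.inl hUt)] at e1
      refine e1.trans (le_of_eq ?_)
      simp only [C, ENNReal.div_eq_inv_mul]
      ring
    · rintro x y z - - - ⟨C, h⟩ ⟨D, h'⟩
      refine ⟨C + D, fun f hf => ?_⟩
      calc ‖c x f - c z f‖ₑ = ‖(c x f - c y f) + (c y f - c z f)‖ₑ := by congr 1; abel
        _ ≤ _ := (enorm_add_le _ _).trans (add_le_add (h f hf) (h' f hf))
        _ = _ := by push_cast; ring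
    · rintro x y - - ⟨C, h⟩
      exact ⟨C, fun f hf => by rw [enorm_sub_rev]; exact h f hf⟩
  obtain ⟨x₀, hx₀⟩ := hΩ.connected.nonempty
  set p : Ω := ⟨x₀, hx₀⟩
  choose D hD using fun x : Ω => hrel x p
  obtain ⟨t, htΩ, htf, hcov⟩ := finite_approx_of_totallyBounded (hΩ.bounded.isCompact_closure.totallyBounded.subset subset_closure) r hr
  set t' : Set Ω := (↑) ⁻¹' t with ht'
  have ht'f : t'.Finite := htf.preimage Subtype.val_injective.injOn
  set S : ℝ≥0∞ := ∑ x ∈ ht'f.toFinset, (A * V + D x * volume Ω) with hS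
  have hSt : S ≠ ⊤ := by
    rw [hS]; exact ENNReal.sum_ne_top.2 fun x _ => by finiteness
  have hsum : ∀ f : Vec n → E, Continuous f →
      ∫⁻ y in Ω, ‖f y - c p f‖ₑ ≤ S * bmoSeminorm Ω f := by
    intro f hf
    have hsub : Ω ⊆ ⋃ x : ht'f.toFinset, ball (x : Vec n) r ∩ Ω := by
      intro y hy
      obtain ⟨x, hx, hyx⟩ := mem_iUnion₂.1 (hcov hy)
      exact mem_iUnion.2 ⟨⟨⟨x, htΩ hx⟩, by simpa [ht'] using hx⟩, hyx, hy⟩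
    calc _ ≤ _ := lintegral_mono_set hsub
      _ ≤ ∑ x ∈ ht'f.toFinset, ∫⁻ y in ball (x : Vec n) r ∩ Ω, ‖f y - c p f‖ₑ := by
          refine (lintegral_iUnion_le _ _).trans (le_of_eq ?_)
          rw [tsum_fintype]
          exact Finset.sum_coe_sort ht'f.toFinset
            (fun x => ∫⁻ y in ball (x : Vec n) r ∩ Ω, ‖f y - c p f‖ₑ)
      _ ≤ ∑ x ∈ ht'f.toFinset, (A * V + D x * volume Ω) * bmoSeminorm Ω f := by
          refine Finset.sum_le_sum fun x _ => ?_
          calc _ ≤ ∫⁻ y in ball (x : Vec n) r ∩ Ω, (‖f y - c x f‖ₑ + ‖c x f - c p f‖ₑ) := by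
                refine lintegral_mono fun y => ?_
                calc ‖f y - c p f‖ₑ = ‖(f y - c x f) + (c x f - c p f)‖ₑ := by congr 1; abel
                  _ ≤ _ := enorm_add_le _ _
            _ = (∫⁻ y in ball (x : Vec n) r ∩ Ω, ‖f y - c x f‖ₑ)
                + ‖c x f - c p f‖ₑ * volume (ball (x : Vec n) r ∩ Ω) := by
                rw [lintegral_add_right _ measurable_const, setLIntegral_const]
            _ ≤ A * bmoSeminorm Ω f * V + (D x * bmoSeminorm Ω f) * volume Ω := by
                refine add_le_add (hc x f hf) ?_
                gcongr
                · exact hD x f hf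
                · exact inter_subset_right
            _ = _ := by ring
      _ = _ := by rw [hS, Finset.sum_mul]
  refine ⟨(2 * S).toNNReal, fun f hf hfc h0 => ?_⟩
  rw [ENNReal.coe_toNNReal (by finiteness)]
  have hfi : Integrable f (volume.restrict Ω) := (hf.integrable_of_hasCompactSupport hfc).restrict
  have hconst : ‖c p f‖ₑ * volume Ω ≤ S * bmoSeminorm Ω f := by
    have : IsFiniteMeasure (volume.restrict Ω) := ⟨by simpa using hfin.lt_top⟩
    have h2 : ∫ y in Ω, (f y - c p f) = - (volume.real Ω • c p f) := by
      rw [integral_sub hfi (integrable_const _), h0, setIntegral_const, zero_sub]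
    have h3 := enorm_integral_le_lintegral_enorm (μ := volume.restrict Ω) (fun y => f y - c p f)
    rw [h2, enorm_neg, enorm_smul] at h3
    have h4 : ‖volume.real Ω‖ₑ = volume Ω := by
      rw [Real.enorm_of_nonneg measureReal_nonneg, Measure.real, ENNReal.ofReal_toReal hfin]
    rw [h4, mul_comm] at h3
    exact h3.trans (hsum f hf)
  calc ∫⁻ y in Ω, ‖f y‖ₑ ≤ ∫⁻ y in Ω, (‖f y - c p f‖ₑ + ‖c p f‖ₑ) := by
        refine lintegral_mono fun y => ?_
        calc ‖f y‖ₑ = ‖(f y - c p f) + c p f‖ₑ := by congr 1; abel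
          _ ≤ _ := enorm_add_le _ _
    _ = (∫⁻ y in Ω, ‖f y - c p f‖ₑ) + ‖c p f‖ₑ * volume Ω := by
        rw [lintegral_add_right _ measurable_const, setLIntegral_const]
    _ ≤ S * bmoSeminorm Ω f + S * bmoSeminorm Ω f := add_le_add (hsum f hf) hconst
    _ = _ := by ring

end OscillationBound

/-! ### From weak estimates at dyadic levels to a strong estimate -/

section DyadicSum

lemma sum_range_two_pow_mul_le (l : ℝ≥0∞) (N : ℕ) :
    ∑ k ∈ Finset.range N, 2 ^ k * l ≤ 2 ^ N * l := by
  induction N with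
  | zero => simp
  | succ N ih =>
    rw [Finset.sum_range_succ, pow_succ, mul_assoc, two_mul, mul_add]
    exact add_le_add_left ih _

/-- A geometric sum over levels below X is at most twice X, the remaining powers of each level are
bounded by those of X, and l < X unless the sum is empty. -/
lemma mul_tsum_two_pow_mul_le {l X : ℝ≥0∞} (j : ℕ) :
    l * ∑' k : ℕ, (if 2 ^ k * l < X then (2 ^ k * l) ^ (j + 1) else 0) ≤ 2 * X ^ (j + 2) := by
  classical
  by_cases hl : l < X
  · have key : ∀ N, ∑ k ∈ Finset.range N, (if 2 ^ k * l < X then 2 ^ k * l else 0) ≤ 2 * X := by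
      intro N
      induction N with
      | zero => simp
      | succ N ih =>
        rw [Finset.sum_range_succ]
        by_cases hN : 2 ^ N * l < X
        · rw [if_pos hN, two_mul]
          refine add_le_add ?_ hN.le
          refine le_trans ?_ ((sum_range_two_pow_mul_le l N).trans hN.le)
          exact Finset.sum_le_sum fun k _ => by split_ifs <;> simp
        · rw [if_neg hN, add_zero]; exact ih
    have h2 : ∑' k : ℕ, (if 2 ^ k * l < X then (2 ^ k * l) ^ (j + 1) else 0) ≤ X ^ j * (2 * X) := by
      refine ENNReal.tsum_le_of_sum_range_le fun N => ?_
      refine le_trans ?_ (mul_le_mul_right (key N) _)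
      rw [Finset.mul_sum]
      refine Finset.sum_le_sum fun k _ => ?_
      split_ifs with h
      · rw [pow_succ]; gcongr
      · simp
    calc _ ≤ X * (X ^ j * (2 * X)) := by gcongr
      _ = _ := by ring
  · have : ∀ k : ℕ, ¬ (2 ^ k * l < X) := fun k hk =>
      hl (lt_of_le_of_lt (le_mul_of_one_le_left' (one_le_pow₀ (by norm_num))) hk)
    simp [this]

/-- Either g ≤ 2l, or some dyadic level s = 2^k l has 2s < g ≤ 4s; the first such bracket already
dominates g. -/
lemma pow_le_add_tsum {l g : ℝ≥0∞} (hl : l ≠ 0) (hg : g ≠ ⊤) (j : ℕ) :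
    g ^ (j + 3) ≤ (2 * l) ^ (j + 1) * g ^ 2
      + ∑' k : ℕ, (if 2 * (2 ^ k * l) < g then (4 * (2 ^ k * l)) ^ (j + 3) else 0) := by
  classical
  by_cases h : g ≤ 2 * l
  · refine le_add_of_le_left ?_
    calc g ^ (j + 3) = g ^ (j + 1) * g ^ 2 := by ring
      _ ≤ _ := by gcongr
  · push Not at h
    have hex : ∃ k : ℕ, g ≤ 2 * (2 ^ k * l) := by
      have hlim : Tendsto (fun k : ℕ => (2 : ℝ≥0∞) ^ k * (2 * l)) atTop (𝓝 (⊤ * (2 * l))) :=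
        ENNReal.Tendsto.mul_const (ENNReal.tendsto_pow_atTop_nhds_top_iff.2 (by norm_num))
          (Or.inl (by simp))
      rw [ENNReal.top_mul (by simp [hl])] at hlim
      obtain ⟨k, hk⟩ := (hlim.eventually (lt_mem_nhds hg.lt_top)).exists
      exact ⟨k, hk.le.trans (le_of_eq (by ring))⟩
    have hs := Nat.find_spec hex
    have h0 : Nat.find hex ≠ 0 := by
      intro h0
      rw [h0] at hs
      simp only [pow_zero, one_mul] at hs
      exact absurd hs (not_le.2 h)
    obtain ⟨i, hi⟩ := Nat.exists_eq_succ_of_ne_zero h0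
    have hmin := not_le.1 (Nat.find_min hex (m := i) (by omega))
    rw [hi] at hs
    refine le_add_of_le_right (le_trans ?_ (ENNReal.le_tsum i))
    rw [if_pos hmin]
    gcongr
    exact hs.trans (le_of_eq (by rw [pow_succ]; ring))

end DyadicSum

/-- Multiply the weak estimate at s = 2^k l by s^(j+1) and sum over k. By the dyadic bound with X =
4g the right side is at most 2 · 4^(2j+5) κ ∫ g^(j+3), that is, at most half of the left side;
values g ≤ 2l contribute (2l)^(j+1) ∫ g². -/
lemma lintegral_pow_le_of_weak_estimate {α : Type*} [MeasurableSpace α] {μ : Measure α}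
    {g : α → ℝ≥0∞} (hg : Measurable g) (hgt : ∀ x, g x ≠ ⊤) (j : ℕ)
    (hfin : ∫⁻ x, g x ^ (j + 3) ∂μ ≠ ⊤) {l κ : ℝ≥0∞} (hl : l ≠ 0) (hlt : l ≠ ⊤)
    (hκ : 2 * (4 ^ (2 * j + 5) * κ) ≤ 2⁻¹)
    (hweak : ∀ s, l ≤ s → s ≠ ⊤ →
      s ^ 2 * μ {x | 2 * s < g x} ≤ κ * l * ∫⁻ x in {x | s < 4 * g x}, g x ∂μ) :
    ∫⁻ x, g x ^ (j + 3) ∂μ ≤ 2 * (2 * l) ^ (j + 1) * ∫⁻ x, g x ^ 2 ∂μ := by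
  classical
  set I := ∫⁻ x, g x ^ (j + 3) ∂μ with hI
  have hm1 : ∀ s : ℝ≥0∞, MeasurableSet {x | 2 * s < g x} := fun s =>
    measurableSet_lt measurable_const hg
  have hm2 : ∀ s : ℝ≥0∞, MeasurableSet {x | s < 4 * g x} := fun s =>
    measurableSet_lt measurable_const (hg.const_mul _)
  have hterm : ∀ k : ℕ, ∫⁻ x, (if 2 * (2 ^ k * l) < g x then (4 * (2 ^ k * l)) ^ (j + 3) else 0) ∂μ
      ≤ 4 ^ (j + 3) * κ * ∫⁻ x, g x * (l * (if 2 ^ k * l < 4 * g x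
          then (2 ^ k * l) ^ (j + 1) else 0)) ∂μ := by
    intro k
    set s := 2 ^ k * l with hs
    have hst : s ≠ ⊤ := by rw [hs]; finiteness
    have h1 : ∫⁻ x, (if 2 * s < g x then (4 * s) ^ (j + 3) else 0) ∂μ
        = (4 * s) ^ (j + 3) * μ {x | 2 * s < g x} := by
      rw [← lintegral_indicator_const (hm1 s)]
      refine lintegral_congr fun x => ?_
      by_cases hx : 2 * s < g x
      · rw [if_pos hx, indicator_of_mem (by exact hx)]
      · rw [if_neg hx, indicator_of_notMem (by exact hx)]
    have h2 : ∫⁻ x, g x * (l * (if s < 4 * g x then s ^ (j + 1) else 0)) ∂μ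
        = l * s ^ (j + 1) * ∫⁻ x in {x | s < 4 * g x}, g x ∂μ := by
      rw [← lintegral_indicator (hm2 s), ← lintegral_const_mul _ (hg.indicator (hm2 s))]
      refine lintegral_congr fun x => ?_
      by_cases hx : s < 4 * g x
      · rw [if_pos hx, indicator_of_mem (by exact hx)]; ring
      · rw [if_neg hx, indicator_of_notMem (by exact hx)]; simp
    rw [h1, h2]
    calc (4 * s) ^ (j + 3) * μ {x | 2 * s < g x}
        = 4 ^ (j + 3) * s ^ (j + 1) * (s ^ 2 * μ {x | 2 * s < g x}) := by ring
      _ ≤ 4 ^ (j + 3) * s ^ (j + 1) * (κ * l * ∫⁻ x in {x | s < 4 * g x}, g x ∂μ) := by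
          exact mul_le_mul_right
            (hweak s (le_mul_of_one_le_left' (one_le_pow₀ (by norm_num))) hst) _
      _ = _ := by ring
  have hmeas : ∀ k : ℕ, Measurable (fun x => if 2 ^ k * l < 4 * g x
          then (2 ^ k * l) ^ (j + 1) else 0) := fun k =>
    Measurable.ite (hm2 _) measurable_const measurable_const
  have hsum : ∑' k : ℕ, ∫⁻ x, (if 2 * (2 ^ k * l) < g x
      then (4 * (2 ^ k * l)) ^ (j + 3) else 0) ∂μ ≤ 2⁻¹ * I := by
    calc _ ≤ ∑' k : ℕ, 4 ^ (j + 3) * κ * ∫⁻ x, g x * (l * (if 2 ^ k * l < 4 * g x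
          then (2 ^ k * l) ^ (j + 1) else 0)) ∂μ := ENNReal.tsum_le_tsum hterm
      _ = 4 ^ (j + 3) * κ * ∫⁻ x, g x * (l * ∑' k : ℕ, (if 2 ^ k * l < 4 * g x
          then (2 ^ k * l) ^ (j + 1) else 0)) ∂μ := by
          rw [ENNReal.tsum_mul_left, ← lintegral_tsum]
          · simp_rw [ENNReal.tsum_mul_left]
          · exact fun k => (hg.mul ((hmeas k).const_mul _)).aemeasurable
      _ ≤ 4 ^ (j + 3) * κ * ∫⁻ x, 2 * 4 ^ (j + 2) * g x ^ (j + 3) ∂μ := by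
          refine mul_le_mul_right (lintegral_mono fun x => ?_) _
          refine (mul_le_mul_right (mul_tsum_two_pow_mul_le j) _).trans (le_of_eq ?_)
          ring
      _ = (2 * (4 ^ (2 * j + 5) * κ)) * I := by
          rw [lintegral_const_mul _ (hg.pow_const _)]; ring
      _ ≤ _ := by gcongr
  have htot : I ≤ (2 * l) ^ (j + 1) * ∫⁻ x, g x ^ 2 ∂μ + 2⁻¹ * I := by
    calc I ≤ ∫⁻ x, ((2 * l) ^ (j + 1) * g x ^ 2
      + ∑' k : ℕ, (if 2 * (2 ^ k * l) < g x then (4 * (2 ^ k * l)) ^ (j + 3) else 0)) ∂μ :=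
          lintegral_mono fun x => pow_le_add_tsum hl (hgt x) j
      _ = (2 * l) ^ (j + 1) * ∫⁻ x, g x ^ 2 ∂μ + ∑' k : ℕ, ∫⁻ x, (if 2 * (2 ^ k * l) < g x
            then (4 * (2 ^ k * l)) ^ (j + 3) else 0) ∂μ := by
          rw [lintegral_add_left ((hg.pow_const _).const_mul _),
            lintegral_const_mul _ (hg.pow_const _), lintegral_tsum]
          exact fun k => (Measurable.ite (hm1 _) measurable_const measurable_const).aemeasurable
      _ ≤ _ := by gcongr
  set X := (2 * l) ^ (j + 1) * ∫⁻ x, g x ^ 2 ∂μ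
  have h2 : I + I ≤ 2 * X + I := by
    calc I + I = 2 * I := (two_mul I).symm
      _ ≤ 2 * (X + 2⁻¹ * I) := by gcongr
      _ = 2 * X + I := by
          rw [mul_add, ← mul_assoc 2 2⁻¹, ENNReal.mul_inv_cancel (by norm_num) (by norm_num),
            one_mul]
  -- Absorption: this is where finiteness of the integral is indispensable.
  have h3 := (ENNReal.add_le_add_iff_right hfin).1 h2
  rw [mul_assoc]
  exact h3

/-! ### Stopping balls and the interpolation between BMO and L² -/

section GoodLambda

variable {n : ℕ} {E : Type*} [NormedAddCommGroup E] {Ω : Set (Vec n)}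
  {f : Vec n → E} {A : NNReal} {r : ℝ} {d l : ℝ≥0∞}

/-- A ball at which the averages of `‖f‖` first exceed `l / 2`. -/
structure IsStoppingBall (Ω : Set (Vec n)) (f : Vec n → E) (l : ℝ≥0∞) (x : Vec n) (ρ : ℝ) :
    Prop where
  pos : 0 < ρ
  lt : l * volume (ball x ρ ∩ Ω) < 2 * ∫⁻ y in ball x ρ ∩ Ω, ‖f y‖ₑ
  le : 2 * ∫⁻ y in ball x (10 * ρ) ∩ Ω, ‖f y‖ₑ ≤ l * volume (ball x (10 * ρ) ∩ Ω)

/-- Among the radii r/10^k take the first at which the average of |f| exceeds l/2. It exists because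
|f| > l near x, and it is not r itself by `h0`, so the next larger radius has a small average. -/
lemma exists_isStoppingBall (hΩ : IsOpen Ω) (hf : Continuous f) (hr : 0 < r) (hl : l ≠ 0)
    (hlt : l ≠ ⊤) {x : Vec n} (hx : x ∈ Ω) (hfx : 2 * l < ‖f x‖ₑ)
    (h0 : 2 * ∫⁻ y in ball x r ∩ Ω, ‖f y‖ₑ ≤ l * volume (ball x r ∩ Ω)) :
    ∃ ρ, 10 * ρ ≤ r ∧ IsStoppingBall Ω f l x ρ := by
  classical
  have hlim : Tendsto (fun k : ℕ => r / 10 ^ k) atTop (𝓝 0) := by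
    have := (tendsto_pow_atTop_nhds_zero_of_lt_one (r := (1 / 10 : ℝ)) (by norm_num)
      (by norm_num)).const_mul r
    simpa [div_eq_mul_inv] using this
  have hnhds : {y | l < ‖f y‖ₑ} ∈ 𝓝 x := by
    refine (isOpen_lt continuous_const hf.enorm).mem_nhds ?_
    exact lt_of_le_of_lt (le_mul_of_one_le_left' (by norm_num)) hfx
  obtain ⟨η, hη, hsub⟩ := Metric.mem_nhds_iff.1 hnhds
  have hex : ∃ k : ℕ, l * volume (ball x (r / 10 ^ k) ∩ Ω)
      < 2 * ∫⁻ y in ball x (r / 10 ^ k) ∩ Ω, ‖f y‖ₑ := by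
    obtain ⟨k, hk⟩ := (hlim.eventually (gt_mem_nhds hη)).exists
    refine ⟨k, ?_⟩
    have hk0 : 0 < r / 10 ^ k := by positivity
    set v := volume (ball x (r / 10 ^ k) ∩ Ω) with hv
    have hv0 : v ≠ 0 := ((isOpen_ball.inter hΩ).measure_pos volume ⟨x, mem_ball_self hk0, hx⟩).ne'
    have hvt : v ≠ ⊤ :=
      ne_top_of_le_ne_top measure_ball_lt_top.ne (measure_mono inter_subset_left)
    have h1 : l * v ≤ ∫⁻ y in ball x (r / 10 ^ k) ∩ Ω, ‖f y‖ₑ := by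
      rw [hv, ← setLIntegral_const]
      refine setLIntegral_mono hf.enorm.measurable fun y hy => ?_
      have : l < ‖f y‖ₑ := hsub (ball_subset_ball hk.le hy.1)
      exact this.le
    refine lt_of_lt_of_le ?_ (mul_le_mul_right h1 2)
    rw [two_mul]
    exact ENNReal.lt_add_right (by finiteness) (mul_ne_zero hl hv0)
  have hs := Nat.find_spec hex
  have hne : Nat.find hex ≠ 0 := by
    intro h
    rw [h] at hs
    simp only [pow_zero, div_one] at hs
    exact absurd hs (not_lt.2 h0)
  obtain ⟨i, hi⟩ := Nat.exists_eq_succ_of_ne_zero hne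
  have hmin := not_lt.1 (Nat.find_min hex (m := i) (by omega))
  rw [hi] at hs
  have e1 : 10 * (r / 10 ^ (i + 1)) = r / 10 ^ i := by rw [pow_succ]; field_simp
  refine ⟨r / 10 ^ (i + 1), ?_, by positivity, hs, by rw [e1]; exact hmin⟩
  rw [e1]
  exact div_le_self hr.le (one_le_pow₀ (by norm_num))

variable [NormedSpace ℝ E]

/-- On the large ball the average of |f| is at most l/2 and the oscillation at most A²d ≤ l/2, so
the comparison constant has |c| ≤ l. Where |f| > 2l one has |f - c| > l, and Chebyshev bounds the
measure by the oscillation. On the small ball the average of |f| exceeds l/2 while the part with |f|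
≤ l/4 contributes at most l/4, so its volume is controlled by the integral over |f| > l/4. -/
lemma IsStoppingBall.measure_le {x : Vec n} {ρ : ℝ} (S : IsStoppingBall Ω f l x ρ)
    (hΩ : IsOpen Ω) (hf : Continuous f) (hb : bmoSeminorm Ω f ≤ d) (hx : x ∈ Ω)
    (hlt : l ≠ ⊤) (hdl : 2 * A ^ 2 * d ≤ l)
    (H : HasOscillationBound E Ω A x (10 * ρ)) (H' : HasOscillationBound E Ω A x ρ) :
    l ^ 2 * volume (ball x (10 * ρ) ∩ Ω ∩ {y | 2 * l < ‖f y‖ₑ})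
      ≤ 4 * A ^ 2 * 10 ^ n * d * ∫⁻ y in ball x ρ ∩ Ω ∩ {y | l < 4 * ‖f y‖ₑ}, ‖f y‖ₑ := by
  obtain ⟨c, hc⟩ := H.osc f hf
  have hρ := S.pos
  set B := ball x (10 * ρ) ∩ Ω with hB
  set v := volume B with hv
  have hv0 : v ≠ 0 :=
    ((isOpen_ball.inter hΩ).measure_pos volume ⟨x, mem_ball_self (by positivity), hx⟩).ne'
  have hvt : v ≠ ⊤ := ne_top_of_le_ne_top measure_ball_lt_top.ne (measure_mono inter_subset_left)
  have hosc : ∫⁻ y in B, ‖f y - c‖ₑ ≤ A * d * volume (ball x (10 * ρ)) := hc.trans (by gcongr)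
  have hcl : ‖c‖ₑ ≤ l := by
    have h1 : ‖c‖ₑ * v ≤ (∫⁻ y in B, ‖f y‖ₑ) + ∫⁻ y in B, ‖f y - c‖ₑ := by
      rw [hv, ← setLIntegral_const, ← lintegral_add_left hf.enorm.measurable]
      refine lintegral_mono fun y => ?_
      calc ‖c‖ₑ = ‖f y - (f y - c)‖ₑ := by congr 1; abel
        _ ≤ _ := enorm_sub_le
    have h2 : 2 * (‖c‖ₑ * v) ≤ 2 * (l * v) := by
      calc 2 * (‖c‖ₑ * v) ≤ 2 * ((∫⁻ y in B, ‖f y‖ₑ) + A * d * volume (ball x (10 * ρ))) := by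
            gcongr; exact h1.trans (by gcongr)
        _ ≤ l * v + 2 * (A * d * (A * v)) := by
            rw [mul_add]
            refine add_le_add S.le ?_
            gcongr
            exact H.volume_le
        _ = l * v + (2 * A ^ 2 * d) * v := by ring
        _ ≤ l * v + l * v := by gcongr
        _ = _ := (two_mul _).symm
    have h3 := (ENNReal.mul_le_mul_iff_right (by norm_num) (by norm_num)).1 h2
    exact (ENNReal.mul_le_mul_iff_left hv0 hvt).1 h3
  have hM : l * volume (B ∩ {y | 2 * l < ‖f y‖ₑ}) ≤ A * d * volume (ball x (10 * ρ)) := by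
    refine le_trans ?_ hosc
    rw [← setLIntegral_const]
    refine (setLIntegral_mono (hf.sub continuous_const).enorm.measurable fun y hy => ?_).trans
      (lintegral_mono_set inter_subset_left)
    have h1 : 2 * l < ‖f y‖ₑ := hy.2
    have h2 : ‖f y‖ₑ ≤ ‖f y - c‖ₑ + ‖c‖ₑ := by
      calc ‖f y‖ₑ = ‖(f y - c) + c‖ₑ := by congr 1; abel
        _ ≤ _ := enorm_add_le _ _
    have h3 : l + l ≤ ‖f y - c‖ₑ + l := by
      rw [← two_mul]; exact h1.le.trans (h2.trans (by gcongr))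
    exact (ENNReal.add_le_add_iff_right hlt).1 h3
  set w := volume (ball x ρ ∩ Ω) with hw
  have hwt : w ≠ ⊤ := ne_top_of_le_ne_top measure_ball_lt_top.ne (measure_mono inter_subset_left)
  have hvol : volume (ball x (10 * ρ)) ≤ 10 ^ n * (A * w) := by
    rw [volume_ball_mul x x (by norm_num)]
    simp only [ENNReal.ofReal_ofNat]
    gcongr
    exact H'.volume_le
  set P := {y | l < 4 * ‖f y‖ₑ} with hP
  have hPm : MeasurableSet P :=
    measurableSet_lt measurable_const (hf.enorm.measurable.const_mul _)
  set I := ∫⁻ y in ball x ρ ∩ Ω ∩ P, ‖f y‖ₑ with hI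
  have hlow : l * w ≤ 4 * I := by
    have h1 : 4 * ∫⁻ y in ball x ρ ∩ Ω, ‖f y‖ₑ ≤ 4 * I + l * w := by
      rw [← lintegral_inter_add_sdiff _ (ball x ρ ∩ Ω) hPm, mul_add]
      refine add_le_add_right ?_ _
      rw [← lintegral_const_mul _ hf.enorm.measurable]
      calc _ ≤ ∫⁻ y in (ball x ρ ∩ Ω) \ P, l := by
            refine setLIntegral_mono measurable_const fun y hy => not_lt.1 hy.2
        _ = l * volume ((ball x ρ ∩ Ω) \ P) := setLIntegral_const _ _
        _ ≤ l * w := mul_le_mul_right (measure_mono sdiff_subset) _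
    have h2 : l * w + l * w ≤ 4 * I + l * w := by
      calc l * w + l * w = 2 * (l * w) := (two_mul _).symm
        _ ≤ 2 * (2 * ∫⁻ y in ball x ρ ∩ Ω, ‖f y‖ₑ) := mul_le_mul_right S.lt.le _
        _ = 4 * ∫⁻ y in ball x ρ ∩ Ω, ‖f y‖ₑ := by rw [← mul_assoc]; norm_num
        _ ≤ _ := h1
    exact (ENNReal.add_le_add_iff_right (by finiteness)).1 h2
  calc l ^ 2 * volume (B ∩ {y | 2 * l < ‖f y‖ₑ})
      = l * (l * volume (B ∩ {y | 2 * l < ‖f y‖ₑ})) := by ring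
    _ ≤ l * (A * d * (10 ^ n * (A * w))) := mul_le_mul_right (hM.trans (by gcongr)) _
    _ = A ^ 2 * 10 ^ n * d * (l * w) := by ring
    _ ≤ A ^ 2 * 10 ^ n * d * (4 * I) := by gcongr
    _ = _ := by ring

/-- Select disjoint stopping balls by Vitali. The enlarged balls cover {|f| > 2l}, while
disjointness lets the integrals over the small balls be summed. -/
lemma sq_mul_measure_le (hΩ : IsOpen Ω) (hf : Continuous f) (hr : 0 < r)
    (hA : ∀ x ∈ Ω, ∀ ρ, 0 < ρ → ρ ≤ r → HasOscillationBound E Ω A x ρ)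
    (hb : bmoSeminorm Ω f ≤ d) (hl : l ≠ 0) (hlt : l ≠ ⊤) (hdl : 2 * A ^ 2 * d ≤ l)
    (h0 : ∀ x ∈ Ω, 2 * ∫⁻ y in ball x r ∩ Ω, ‖f y‖ₑ ≤ l * volume (ball x r ∩ Ω)) :
    l ^ 2 * volume (Ω ∩ {y | 2 * l < ‖f y‖ₑ})
      ≤ 4 * A ^ 2 * 10 ^ n * d * ∫⁻ y in Ω ∩ {y | l < 4 * ‖f y‖ₑ}, ‖f y‖ₑ := by
  set Z := Ω ∩ {y | 2 * l < ‖f y‖ₑ} with hZ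
  have hex : ∀ x, ∃ ρ, x ∈ Z → 10 * ρ ≤ r ∧ IsStoppingBall Ω f l x ρ := by
    intro x
    by_cases hx : x ∈ Z
    · obtain ⟨ρ, h⟩ := exists_isStoppingBall hΩ hf hr hl hlt hx.1 hx.2 (h0 x hx.1)
      exact ⟨ρ, fun _ => h⟩
    · exact ⟨0, fun h => absurd h hx⟩
  choose ρ hρ using hex
  obtain ⟨u, huZ, hdis, hcov⟩ := Vitali.exists_disjoint_subfamily_covering_enlargement_closedBall
    Z id ρ r (fun a ha => by have := (hρ a ha).1; have := (hρ a ha).2.pos; linarith) 5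
    (by norm_num)
  simp only [id] at hdis hcov
  have hdis' : u.PairwiseDisjoint fun a => ball a (ρ a) := hdis.mono fun a => ball_subset_closedBall
  have hcount : u.Countable := hdis'.countable_of_isOpen (fun _ _ => isOpen_ball)
    fun a ha => ⟨a, mem_ball_self (hρ a (huZ ha)).2.pos⟩
  set P := {y | l < 4 * ‖f y‖ₑ} with hP
  have hPm : MeasurableSet P :=
    measurableSet_lt measurable_const (hf.enorm.measurable.const_mul _)
  have hZsub : Z ⊆ ⋃ a ∈ u, ball a (10 * ρ a) ∩ Ω ∩ {y | 2 * l < ‖f y‖ₑ} := by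
    intro y hy
    obtain ⟨a, ha, hsub⟩ := hcov y hy
    refine mem_iUnion₂.2 ⟨a, ha, ⟨?_, hy.1⟩, hy.2⟩
    have h1 := hsub (mem_closedBall_self (hρ y hy).2.pos.le)
    have h2 := (hρ a (huZ ha)).2.pos
    -- Vitali gives closed balls of radius 5ρ; the stopping ratio 10 leaves room for open ones.
    exact closedBall_subset_ball (by linarith) h1
  calc l ^ 2 * volume Z
      ≤ l ^ 2 * ∑' a : u, volume (ball (a : Vec n) (10 * ρ a) ∩ Ω ∩ {y | 2 * l < ‖f y‖ₑ}) := by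
        gcongr
        exact (measure_mono hZsub).trans (measure_biUnion_le volume hcount _)
    _ = ∑' a : u, l ^ 2 * volume (ball (a : Vec n) (10 * ρ a) ∩ Ω ∩ {y | 2 * l < ‖f y‖ₑ}) :=
        ENNReal.tsum_mul_left.symm
    _ ≤ ∑' a : u, 4 * A ^ 2 * 10 ^ n * d * ∫⁻ y in ball (a : Vec n) (ρ a) ∩ Ω ∩ P, ‖f y‖ₑ := by
        refine ENNReal.tsum_le_tsum fun a => ?_
        have ha := huZ a.2
        obtain ⟨h1, h2⟩ := hρ a ha
        have h3 := h2.pos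
        exact h2.measure_le hΩ hf hb ha.1 hlt hdl (hA a ha.1 _ (by positivity) h1)
          (hA a ha.1 _ h3 (by linarith))
    _ = 4 * A ^ 2 * 10 ^ n * d * ∫⁻ y in ⋃ a ∈ u, ball a (ρ a) ∩ Ω ∩ P, ‖f y‖ₑ := by
        rw [ENNReal.tsum_mul_left, lintegral_biUnion hcount
          (fun a _ => (measurableSet_ball.inter hΩ.measurableSet).inter hPm)]
        exact hdis'.mono fun a => inter_subset_left.trans inter_subset_left
    _ ≤ _ := by
        gcongr
        exact iUnion₂_subset fun a _ y hy => ⟨hy.1.2, hy.2⟩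

/-- Interpolation between `BMO` and `L²` for functions of mean zero on a Lipschitz domain. -/
theorem IsLipschitzDomain.lintegral_pow_le_mul_lintegral_sq [CompleteSpace E]
    (hΩ : IsLipschitzDomain Ω) (j : ℕ) {ε : ℝ} (hε : 0 < ε) :
    ∃ δ : ℝ, 0 < δ ∧ ∀ f : Vec n → E, Continuous f → HasCompactSupport f → ∫ x in Ω, f x = 0 →
      bmoSeminorm Ω f ≤ ENNReal.ofReal δ →
      ∫⁻ x in Ω, ‖f x‖ₑ ^ (j + 3) ≤ ENNReal.ofReal ε * ∫⁻ x in Ω, ‖f x‖ₑ ^ 2 := by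
  obtain ⟨r, hr, A, hA⟩ := hΩ.exists_hasOscillationBound (E := E)
  obtain ⟨C, hC⟩ := hΩ.exists_lintegral_le_bmoSeminorm (E := E)
  set V := volume.real (ball (0 : Vec n) r) with hV
  have hV0 : 0 < V := by
    rw [hV, Measure.real, ENNReal.toReal_pos_iff]
    exact ⟨measure_ball_pos _ _ hr, measure_ball_lt_top⟩
  -- This gives 2(2l)^(j+1) ≤ 4l ≤ ε, the factor produced by the dyadic summation.
  set l : ℝ := min (1 / 2) (ε / 4) with hl
  have hl0 : 0 < l := by positivity
  -- With δ = l/D the last three summands give, in order: the oscillation is small against l,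
  -- averages at scale r are at most l/2, and the weak estimate holds with κ = 4^(-(2j+6)), for
  -- which 2 · 4^(2j+5) κ = 1/2.
  set D : ℝ := 1 + 2 * A ^ 2 + 2 * A * C / V + 4 * A ^ 2 * 10 ^ n * 4 ^ (2 * j + 6) with hD
  have hD0 : 0 < D := by positivity
  refine ⟨l / D, by positivity, fun f hf hfc hf0 hb => ?_⟩
  set δ := l / D with hδ
  have hδ0 : 0 < δ := by positivity
  have hδD : δ * D = l := by rw [hδ]; field_simp
  have d1 : 2 * A ^ 2 * δ ≤ l := by
    rw [← hδD, mul_comm]; gcongr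
    rw [hD]
    have : 0 ≤ 2 * (A : ℝ) * C / V := by positivity
    have : 0 ≤ 4 * (A : ℝ) ^ 2 * 10 ^ n * 4 ^ (2 * j + 6) := by positivity
    linarith
  have d2 : 2 * A * C * δ ≤ l * V := by
    have h1 : 2 * A * C / V ≤ D := by
      rw [hD]
      have : 0 ≤ 2 * (A : ℝ) ^ 2 := by positivity
      have : 0 ≤ 4 * (A : ℝ) ^ 2 * 10 ^ n * 4 ^ (2 * j + 6) := by positivity
      linarith
    rw [div_le_iff₀ hV0] at h1
    rw [← hδD]
    nlinarith
  have d3 : 4 * A ^ 2 * 10 ^ n * δ ≤ (4 ^ (2 * j + 6))⁻¹ * l := by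
    have h1 : 4 * (A : ℝ) ^ 2 * 10 ^ n * 4 ^ (2 * j + 6) ≤ D := by
      rw [hD]
      have : 0 ≤ 2 * (A : ℝ) ^ 2 := by positivity
      have : 0 ≤ 2 * (A : ℝ) * C / V := by positivity
      linarith
    rw [← hδD, ← div_eq_inv_mul, le_div_iff₀ (by positivity)]
    nlinarith
  set L := ENNReal.ofReal l with hL
  set d := ENNReal.ofReal δ with hd
  have hA' : ENNReal.ofReal (A : ℝ) = A := ENNReal.ofReal_coe_nnreal
  have hC' : ENNReal.ofReal (C : ℝ) = C := ENNReal.ofReal_coe_nnreal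
  have hV' : ENNReal.ofReal V = volume (ball (0 : Vec n) r) :=
    ENNReal.ofReal_toReal measure_ball_lt_top.ne
  have D1 : 2 * A ^ 2 * d ≤ L := by
    have := ENNReal.ofReal_le_ofReal d1
    rwa [ENNReal.ofReal_mul (by positivity), ENNReal.ofReal_mul (by positivity),
      ENNReal.ofReal_pow (by positivity), hA', ENNReal.ofReal_ofNat] at this
  have D2 : 2 * A * C * d ≤ L * volume (ball (0 : Vec n) r) := by
    have := ENNReal.ofReal_le_ofReal d2
    rwa [ENNReal.ofReal_mul (by positivity), ENNReal.ofReal_mul (by positivity),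
      ENNReal.ofReal_mul (by positivity), ENNReal.ofReal_mul (by positivity), hA', hC', hV',
      ENNReal.ofReal_ofNat] at this
  have D3 : 4 * A ^ 2 * 10 ^ n * d ≤ (4 ^ (2 * j + 6))⁻¹ * L := by
    have := ENNReal.ofReal_le_ofReal d3
    rwa [ENNReal.ofReal_mul (by positivity), ENNReal.ofReal_mul (by positivity),
      ENNReal.ofReal_mul (by positivity), ENNReal.ofReal_mul (by positivity),
      ENNReal.ofReal_pow (by positivity), ENNReal.ofReal_pow (by positivity),
      ENNReal.ofReal_inv_of_pos (by positivity), ENNReal.ofReal_pow (by positivity), hA',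
      ENNReal.ofReal_ofNat, ENNReal.ofReal_ofNat] at this
  have hL0 : L ≠ 0 := (ENNReal.ofReal_pos.2 hl0).ne'
  have hfin : ∫⁻ x in Ω, ‖f x‖ₑ ^ (j + 3) ≠ ⊤ := by
    have h1 : Integrable (fun x => ‖f x‖ ^ (j + 3)) (volume.restrict Ω) := by
      refine (Continuous.integrable_of_hasCompactSupport (by fun_prop) ?_).restrict
      exact hfc.norm.comp_left (g := fun t : ℝ => t ^ (j + 3)) (by simp)
    have := h1.2.ne
    simpa [hasFiniteIntegral_iff_enorm, enorm_pow] using this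
  have hmain := lintegral_pow_le_of_weak_estimate (μ := volume.restrict Ω) (g := fun x => ‖f x‖ₑ)
    hf.enorm.measurable (fun x => enorm_ne_top) j hfin hL0 ENNReal.ofReal_ne_top
    (κ := (4 ^ (2 * j + 6))⁻¹) ?_ ?_
  · refine hmain.trans ?_
    gcongr
    have h1 : 2 * (2 * l) ^ (j + 1) ≤ ε := by
      have h2 : 2 * l ≤ 1 := by have := min_le_left (1 / 2) (ε / 4); linarith
      have h3 : 4 * l ≤ ε := by have := min_le_right (1 / 2) (ε / 4); linarith
      have h4 : (2 * l) ^ j ≤ 1 := pow_le_one₀ (by positivity) h2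
      rw [pow_succ]
      nlinarith
    have := ENNReal.ofReal_le_ofReal h1
    rwa [ENNReal.ofReal_mul (by positivity), ENNReal.ofReal_pow (by positivity),
      ENNReal.ofReal_mul (by positivity), ENNReal.ofReal_ofNat] at this
  · have : (4 : ℝ≥0∞) ^ (2 * j + 6) = 4 ^ (2 * j + 5) * 4 := pow_succ _ _
    rw [this, ENNReal.mul_inv (by simp) (by simp), ← mul_assoc (4 ^ (2 * j + 5)),
      ENNReal.mul_inv_cancel (by simp) (by simp), one_mul]
    rw [show (4 : ℝ≥0∞) = 2 * 2 by norm_num, ENNReal.mul_inv (by simp) (by simp), ← mul_assoc,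
      ENNReal.mul_inv_cancel (by simp) (by simp), one_mul]
  · intro s hs hst
    rw [Measure.restrict_apply (measurableSet_lt measurable_const hf.enorm.measurable),
      Measure.restrict_restrict (measurableSet_lt measurable_const
        (hf.enorm.measurable.const_mul _)), inter_comm, inter_comm {x | s < 4 * ‖f x‖ₑ}]
    refine (sq_mul_measure_le hΩ.isOpen hf hr hA hb (fun h => hL0 (by simpa [h] using hs)) hst
      (D1.trans hs) ?_).trans ?_
    · intro x hx
      calc 2 * ∫⁻ y in ball x r ∩ Ω, ‖f y‖ₑ ≤ 2 * (C * d) := by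
            gcongr
            exact (lintegral_mono_set inter_subset_right).trans ((hC f hf hfc hf0).trans
              (by gcongr))
        _ ≤ s * volume (ball x r ∩ Ω) := by
            have hv := (hA x hx r hr le_rfl).volume_le
            rw [Measure.addHaar_ball_center] at hv
            by_cases hA0 : (A : ℝ≥0∞) = 0
            · rw [hA0, zero_mul] at hv
              exact absurd (le_zero_iff.1 hv) (measure_ball_pos _ _ hr).ne'
            refine (ENNReal.mul_le_mul_iff_right hA0 ENNReal.coe_ne_top).1 ?_
            calc (A : ℝ≥0∞) * (2 * (C * d)) = 2 * A * C * d := by ring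
              _ ≤ L * volume (ball (0 : Vec n) r) := D2
              _ ≤ s * (A * volume (ball x r ∩ Ω)) := by gcongr
              _ = _ := by ring
    · gcongr

end GoodLambda

/-! ### Second-order Taylor estimate -/

section Taylor

/-- The mean value inequality is used twice: for the derivative of f minus its linearisation on the
ball, then for the remainder along the segment from z to z + ξ. -/
lemma abs_taylor_two_le {V : Type*} [NormedAddCommGroup V] [NormedSpace ℝ V] {f : V → ℝ}
    (hf : ContDiff ℝ 2 f) (z ξ : V) {C : ℝ}
    (hC : ∀ w ∈ closedBall z ‖ξ‖, ‖fderiv ℝ (fderiv ℝ f) w - fderiv ℝ (fderiv ℝ f) z‖ ≤ C) :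
    |f (z + ξ) - f z - fderiv ℝ f z ξ - 1 / 2 * fderiv ℝ (fderiv ℝ f) z ξ ξ| ≤ C * ‖ξ‖ ^ 2 := by
  have hd : Differentiable ℝ f := hf.differentiable (by norm_num)
  have hd2 : Differentiable ℝ (fderiv ℝ f) :=
    (hf.fderiv_right (m := 1) (by norm_num)).differentiable (by norm_num)
  set H := fderiv ℝ (fderiv ℝ f) z with hH
  have hC0 : 0 ≤ C := (norm_nonneg (fderiv ℝ (fderiv ℝ f) z - H)).trans (hC z (mem_closedBall_self (norm_nonneg _)))
  set g : ℝ → ℝ := fun t => f (z + t • ξ) - t * fderiv ℝ f z ξ - t ^ 2 / 2 * H ξ ξ with hg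
  set g' : ℝ → ℝ := fun t => fderiv ℝ f (z + t • ξ) ξ - fderiv ℝ f z ξ - t * H ξ ξ with hg'
  have hderiv : ∀ t, HasDerivAt g (g' t) t := by
    intro t
    have h1 : HasDerivAt (fun t : ℝ => z + t • ξ) ξ t := by
      simpa using ((hasDerivAt_id t).smul_const ξ).const_add z
    have h2 := (hd (z + t • ξ)).hasFDerivAt.comp_hasDerivAt t h1
    have h3 : HasDerivAt (fun t : ℝ => t * fderiv ℝ f z ξ) (fderiv ℝ f z ξ) t := by
      simpa using (hasDerivAt_id t).mul_const (fderiv ℝ f z ξ)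
    have h4 : HasDerivAt (fun t : ℝ => t ^ 2 / 2 * H ξ ξ) (t * H ξ ξ) t := by
      have := ((hasDerivAt_pow 2 t).div_const 2).mul_const (H ξ ξ)
      simpa using this
    exact (h2.sub h3).sub h4
  have hbound : ∀ t ∈ Ico (0 : ℝ) 1, ‖g' t‖ ≤ C * ‖ξ‖ ^ 2 := by
    intro t ht
    have hmem : z + t • ξ ∈ closedBall z ‖ξ‖ := by
      rw [mem_closedBall, dist_eq_norm, add_sub_cancel_left, norm_smul, Real.norm_of_nonneg ht.1]
      exact mul_le_of_le_one_left (norm_nonneg _) ht.2.le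
    have h1 := Convex.norm_image_sub_le_of_norm_fderiv_le' (f := fderiv ℝ f) (φ := H)
      (fun w _ => hd2 w) hC (convex_closedBall z ‖ξ‖)
      (mem_closedBall_self (norm_nonneg _)) hmem
    rw [add_sub_cancel_left, norm_smul, Real.norm_of_nonneg ht.1] at h1
    have h2 : g' t = (fderiv ℝ f (z + t • ξ) - fderiv ℝ f z - H (t • ξ)) ξ := by
      simp [hg']
    rw [h2]
    calc _ ≤ ‖fderiv ℝ f (z + t • ξ) - fderiv ℝ f z - H (t • ξ)‖ * ‖ξ‖ :=
          ContinuousLinearMap.le_opNorm _ _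
      _ ≤ C * (t * ‖ξ‖) * ‖ξ‖ := by gcongr
      _ ≤ C * (1 * ‖ξ‖) * ‖ξ‖ := by gcongr; exact ht.2.le
      _ = _ := by ring
  have := norm_image_sub_le_of_norm_deriv_le_segment_01'
    (fun t _ => (hderiv t).hasDerivWithinAt) hbound
  rw [Real.norm_eq_abs] at this
  convert this using 2
  simp only [hg, one_smul, zero_smul, add_zero]
  ring

end Taylor

/-! ### Uniform bounds for the integrand -/

section Integrand

variable {n N : ℕ} {Ω : Set (Vec n)} {F : Vec n → Mat N n → ℝ} {p : ℝ}

lemma HypReg.exists_bound (hΩ : Bornology.IsBounded Ω) (hF0 : HypReg Ω F) (M : ℝ) :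
    ∃ B : ℝ, 0 ≤ B ∧ ∀ x ∈ closure Ω, ∀ z, ‖z‖ ≤ M → ‖hessZ F x z‖ ≤ B := by
  have hK : IsCompact (closure Ω ×ˢ closedBall (0 : Mat N n) M) :=
    hΩ.isCompact_closure.prod (isCompact_closedBall _ _)
  have hcont : ContinuousOn (fun q : Vec n × Mat N n => hessZ F q.1 q.2)
      (closure Ω ×ˢ closedBall (0 : Mat N n) M) :=
    hF0.continuous_hess.mono (prod_mono_right (subset_univ _))
  obtain ⟨B, hB⟩ := hK.exists_bound_of_continuousOn
    (f := fun q : Vec n × Mat N n => hessZ F q.1 q.2) hcont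
  refine ⟨max B 0, le_max_right _ _, fun x hx z hz => ?_⟩
  exact (hB (x, z) ⟨hx, by simpa using hz⟩).trans (le_max_left _ _)

lemma HypReg.exists_modulus (hΩ : Bornology.IsBounded Ω) (hF0 : HypReg Ω F) (M : ℝ) {ε : ℝ}
    (hε : 0 < ε) : ∃ η : ℝ, 0 < η ∧ η ≤ 1 ∧ ∀ x ∈ closure Ω, ∀ z w : Mat N n, ‖z‖ ≤ M →
      ‖w - z‖ ≤ η → ‖hessZ F x w - hessZ F x z‖ ≤ ε := by
  have hK : IsCompact (closure Ω ×ˢ closedBall (0 : Mat N n) (M + 1)) :=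
    hΩ.isCompact_closure.prod (isCompact_closedBall _ _)
  have hcont : ContinuousOn (fun q : Vec n × Mat N n => hessZ F q.1 q.2)
      (closure Ω ×ˢ closedBall (0 : Mat N n) (M + 1)) :=
    hF0.continuous_hess.mono (prod_mono_right (subset_univ _))
  have huc := hK.uniformContinuousOn_of_continuous
    (f := fun q : Vec n × Mat N n => hessZ F q.1 q.2) hcont
  obtain ⟨δ, hδ, h⟩ := (Metric.uniformContinuousOn_iff
    (f := fun q : Vec n × Mat N n => hessZ F q.1 q.2)).1 huc ε hε
  refine ⟨min (δ / 2) 1, by positivity, min_le_right _ _, fun x hx z w hz hw => ?_⟩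
  have h1 : ‖w - z‖ ≤ 1 := hw.trans (min_le_right _ _)
  have h2 : ‖w - z‖ ≤ δ / 2 := hw.trans (min_le_left _ _)
  have h3 : ‖w‖ ≤ M + 1 := by
    have := norm_add_le z (w - z); rw [add_sub_cancel] at this; linarith
  have := h (x, w) ⟨hx, by simpa using h3⟩ (x, z) ⟨hx, by simp; linarith⟩ (by
    rw [Prod.dist_eq]; simp only [dist_self, dist_eq_norm]
    rw [max_eq_right (norm_nonneg _)]; linarith)
  exact (dist_eq_norm (hessZ F x w) (hessZ F x z)).symm.le.trans this.le

/-- No joint continuity of F_z is assumed. For a unit vector ξ, Taylor's formula expresses F_z(x,z)ξ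
through two values of F, bounded by growth, and second-order terms, bounded by B/2 + 2B ≤ 3B. -/
lemma exists_fderiv_bound (hΩ : Bornology.IsBounded Ω) (hp : 0 ≤ p) (hF0 : HypReg Ω F)
    (hF1 : HypGrowth Ω p F) {M : ℝ} (hM : 0 ≤ M) :
    ∃ B : ℝ, 0 ≤ B ∧ ∀ x ∈ closure Ω, ∀ z, ‖z‖ ≤ M → ‖fderiv ℝ (F x) z‖ ≤ B := by
  obtain ⟨B, hB0, hB⟩ := hF0.exists_bound hΩ (M + 1)
  obtain ⟨c₁, hc₁, hgr⟩ := hF1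
  have hgr' : ∀ x ∈ closure Ω, ∀ w, ‖w‖ ≤ M + 1 → |F x w| ≤ c₁ * (1 + (M + 1) ^ p) := by
    intro x hx w hw
    refine (hgr x hx w).trans ?_
    gcongr
  have h0 : 0 ≤ c₁ * (1 + (M + 1) ^ p) := by positivity
  refine ⟨2 * (c₁ * (1 + (M + 1) ^ p)) + 3 * B, by positivity, fun x hx z hz => ?_⟩
  refine ContinuousLinearMap.opNorm_le_of_unit_norm (by positivity) fun ξ hξ => ?_
  have hT := abs_taylor_two_le (hF0.contDiff x hx) z ξ (C := 2 * B) (fun w hw => by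
    rw [mem_closedBall, dist_eq_norm, hξ] at hw
    have h1 : ‖w‖ ≤ M + 1 := by
      have := norm_add_le z (w - z); rw [add_sub_cancel] at this; linarith
    refine (norm_sub_le (fderiv ℝ (fderiv ℝ (F x)) w) (fderiv ℝ (fderiv ℝ (F x)) z)).trans ?_
    have a1 := hB x hx w h1
    have a2 := hB x hx z (by linarith)
    simp only [hessZ] at a1 a2
    linarith)
  have h1 := hgr' x hx (z + ξ) ((norm_add_le _ _).trans (by linarith))
  have h2 := hgr' x hx z (by linarith)
  have h3 : |fderiv ℝ (fderiv ℝ (F x)) z ξ ξ| ≤ B := by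
    have a := (fderiv ℝ (fderiv ℝ (F x)) z).le_opNorm₂ ξ ξ
    rw [hξ, mul_one, mul_one, Real.norm_eq_abs] at a
    exact a.trans (hB x hx z (by linarith))
  rw [hξ] at hT
  rw [Real.norm_eq_abs]
  rw [abs_le] at *
  constructor <;> linarith [hT.1, hT.2, h1.1, h1.2, h2.1, h2.2, h3.1, h3.2]

/-- For |ξ| ≤ η the modulus of continuity of F_zz gives ε|ξ|². For |ξ| > η each term separately is
at most a constant times (|ξ|/η)^q, because q dominates 2 and p. -/
lemma exists_remainder_bound (hΩ : Bornology.IsBounded Ω) (hp : 0 ≤ p) (hF0 : HypReg Ω F)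
    (hF1 : HypGrowth Ω p F) {M : ℝ} (hM : 0 ≤ M) {q : ℕ} (hq : 2 ≤ q) (hpq : p ≤ q) {ε : ℝ}
    (hε : 0 < ε) :
    ∃ C : ℝ, 0 ≤ C ∧ ∀ x ∈ closure Ω, ∀ z ξ : Mat N n, ‖z‖ ≤ M →
      |F x (z + ξ) - F x z - fderiv ℝ (F x) z ξ - 1 / 2 * hessZ F x z ξ ξ|
        ≤ ε * ‖ξ‖ ^ 2 + C * ‖ξ‖ ^ q := by
  obtain ⟨B, hB0, hB⟩ := hF0.exists_bound hΩ M
  obtain ⟨B', hB'0, hB'⟩ := exists_fderiv_bound hΩ hp hF0 hF1 hM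
  obtain ⟨η, hη0, hη1, hη⟩ := hF0.exists_modulus hΩ M hε
  obtain ⟨c₁, hc₁, hgr⟩ := hF1
  set D := 2 * c₁ * (1 + (M + 1) ^ p) + B' + B with hD
  have hD0 : 0 ≤ D := by positivity
  refine ⟨D / η ^ q, by positivity, fun x hx z ξ hz => ?_⟩
  by_cases hξ : ‖ξ‖ ≤ η
  · have hT := abs_taylor_two_le (hF0.contDiff x hx) z ξ (C := ε) (fun w hw => by
      rw [mem_closedBall, dist_eq_norm] at hw
      exact hη x hx z w hz (hw.trans hξ))
    have : 0 ≤ D / η ^ q * ‖ξ‖ ^ q := by positivity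
    exact hT.trans (by linarith)
  · push Not at hξ
    set t := ‖ξ‖ / η with ht
    have ht1 : 1 ≤ t := by rw [ht, le_div_iff₀ hη0]; linarith
    have hξt : ‖ξ‖ ≤ t := by rw [ht]; exact le_div_self (norm_nonneg _) hη0 hη1
    have ht2 : t ^ 2 ≤ t ^ q := pow_le_pow_right₀ ht1 hq
    have htq1 : 1 ≤ t ^ q := one_le_pow₀ ht1
    have htq : t ≤ t ^ q := by nlinarith
    have htp : t ^ p ≤ t ^ q := by
      rw [← Real.rpow_natCast]; exact Real.rpow_le_rpow_of_exponent_le ht1 hpq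
    have hM1 : (1 : ℝ) ≤ (M + 1) := by linarith
    have hg : ∀ w : Mat N n, ‖w‖ ≤ (M + 1) * t → |F x w| ≤ c₁ * (1 + (M + 1) ^ p) * t ^ q := by
      intro w hw
      refine (hgr x hx w).trans ?_
      have h1 : ‖w‖ ^ p ≤ ((M + 1) * t) ^ p := Real.rpow_le_rpow (norm_nonneg _) hw hp
      rw [Real.mul_rpow (by positivity) (by positivity)] at h1
      have h2 : 0 ≤ (M + 1) ^ p := by positivity
      have h3 : ‖w‖ ^ p ≤ (M + 1) ^ p * t ^ q := h1.trans (mul_le_mul_of_nonneg_left htp h2)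
      rw [mul_assoc, add_mul, one_mul]
      exact mul_le_mul_of_nonneg_left (by linarith) hc₁.le
    have a1 := hg (z + ξ) ((norm_add_le _ _).trans (by nlinarith))
    have a2 := hg z (by nlinarith)
    have a3 : |fderiv ℝ (F x) z ξ| ≤ B' * t ^ q := by
      refine ((fderiv ℝ (F x) z).le_opNorm ξ).trans ?_
      exact mul_le_mul (hB' x hx z hz) (hξt.trans htq) (norm_nonneg _) hB'0
    have a4 : |hessZ F x z ξ ξ| ≤ B * t ^ q := by
      refine ((hessZ F x z).le_opNorm₂ ξ ξ).trans ?_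
      rw [mul_assoc]
      refine mul_le_mul (hB x hx z hz) ?_ (by positivity) hB0
      calc ‖ξ‖ * ‖ξ‖ ≤ t * t := by gcongr
        _ = t ^ 2 := by ring
        _ ≤ _ := ht2
    have e1 : D / η ^ q * ‖ξ‖ ^ q = D * t ^ q := by rw [ht, div_pow]; ring
    have e2 : D * t ^ q = c₁ * (1 + (M + 1) ^ p) * t ^ q + c₁ * (1 + (M + 1) ^ p) * t ^ q
        + B' * t ^ q + B * t ^ q := by rw [hD]; ring
    have e3 : 0 ≤ ε * ‖ξ‖ ^ 2 := by positivity
    have e4 : 0 ≤ B * t ^ q := by positivity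
    rw [e1, e2]
    rw [abs_le] at *
    constructor <;> linarith [a1.1, a1.2, a2.1, a2.2, a3.1, a3.2, a4.1, a4.2]

end Integrand

/-! ### Measurability of F, F_z and F_zz along measurable maps -/

section Measurability

variable {α V : Type*} [MeasurableSpace α] {μ : Measure α} [NormedAddCommGroup V]

/-- Composition of a Carathéodory function with a measurable map. -/
lemma aestronglyMeasurable_comp_of_continuous {F : α → V → ℝ}
    (hm : ∀ z, AEStronglyMeasurable (fun x => F x z) μ) (hc : ∀ᵐ x ∂μ, Continuous (F x))
    {v : α → V} (hv : AEStronglyMeasurable v μ) :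
    AEStronglyMeasurable (fun x => F x (v x)) μ := by
  classical
  have hmk := hv.stronglyMeasurable_mk
  have hs : ∀ s : SimpleFunc α V, AEStronglyMeasurable (fun x => F x (s x)) μ := by
    intro s
    have h1 : (fun x => F x (s x))
        = fun x => ∑ z ∈ s.range, (s ⁻¹' {z}).indicator (fun x => F x z) x := by
      ext x
      rw [Finset.sum_eq_single (s x)]
      · rw [indicator_of_mem (by simp)]
      · intro z _ hz
        exact indicator_of_notMem (fun h => hz (by simpa using h.symm)) _
      · intro h
        exact absurd (s.mem_range_self x) h
    rw [h1]
    exact Finset.aestronglyMeasurable_fun_sum _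
      fun z _ => (hm z).indicator (s.measurableSet_fiber z)
  have h2 : AEStronglyMeasurable (fun x => F x (hv.mk v x)) μ := by
    refine aestronglyMeasurable_of_tendsto_ae atTop (fun k => hs (hmk.approx k)) ?_
    filter_upwards [hc] with x hx
    exact (hx.tendsto _).comp (hmk.tendsto_approx x)
  refine h2.congr ?_
  filter_upwards [hv.ae_eq_mk] with x hx
  rw [← hx]

variable [NormedSpace ℝ V] {F : α → V → ℝ}

lemma tendsto_norm_natCast_succ : Tendsto (fun k : ℕ => ‖((k : ℝ) + 1)‖) atTop atTop :=
  tendsto_norm_atTop_atTop.comp (tendsto_atTop_add_const_right _ _ tendsto_natCast_atTop_atTop)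

/-- The directional derivative is the limit of difference quotients of Carathéodory compositions;
the second-derivative version iterates this. -/
lemma aestronglyMeasurable_fderiv_comp
    (hm : ∀ z, AEStronglyMeasurable (fun x => F x z) μ) (hc : ∀ᵐ x ∂μ, ContDiff ℝ 2 (F x))
    {v ξ : α → V} (hv : AEStronglyMeasurable v μ) (hξ : AEStronglyMeasurable ξ μ) :
    AEStronglyMeasurable (fun x => fderiv ℝ (F x) (v x) (ξ x)) μ := by
  have hc' : ∀ᵐ x ∂μ, Continuous (F x) := hc.mono fun x h => h.continuous
  refine aestronglyMeasurable_of_tendsto_ae (u := atTop) (f := fun (k : ℕ) x =>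
    ((k : ℝ) + 1) • (F x (v x + ((k : ℝ) + 1)⁻¹ • ξ x) - F x (v x))) (fun k => ?_) ?_
  · exact ((aestronglyMeasurable_comp_of_continuous hm hc' (hv.add (hξ.const_smul ((k : ℝ) + 1)⁻¹))).sub
      (aestronglyMeasurable_comp_of_continuous hm hc' hv)).const_smul ((k : ℝ) + 1)
  · filter_upwards [hc] with x hx
    exact (hx.differentiable (by norm_num) (v x)).hasFDerivAt.lim (ξ x) tendsto_norm_natCast_succ

lemma aestronglyMeasurable_fderiv_fderiv_comp
    (hm : ∀ z, AEStronglyMeasurable (fun x => F x z) μ) (hc : ∀ᵐ x ∂μ, ContDiff ℝ 2 (F x))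
    {v ξ : α → V} (hv : AEStronglyMeasurable v μ) (hξ : AEStronglyMeasurable ξ μ) :
    AEStronglyMeasurable (fun x => fderiv ℝ (fderiv ℝ (F x)) (v x) (ξ x) (ξ x)) μ := by
  refine aestronglyMeasurable_of_tendsto_ae (u := atTop) (f := fun (k : ℕ) x =>
    ((k : ℝ) + 1) • (fderiv ℝ (F x) (v x + ((k : ℝ) + 1)⁻¹ • ξ x) (ξ x)
      - fderiv ℝ (F x) (v x) (ξ x))) (fun k => ?_) ?_
  · exact ((aestronglyMeasurable_fderiv_comp hm hc (hv.add (hξ.const_smul ((k : ℝ) + 1)⁻¹)) hξ).sub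
      (aestronglyMeasurable_fderiv_comp hm hc hv hξ)).const_smul ((k : ℝ) + 1)
  · filter_upwards [hc] with x hx
    have h1 := (((hx.fderiv_right (m := 1) (by norm_num)).differentiable (by norm_num))
      (v x)).hasFDerivAt.lim (ξ x) tendsto_norm_natCast_succ
    have h2 := ((ContinuousLinearMap.apply ℝ ℝ (ξ x)).continuous.tendsto _).comp h1
    simpa [Function.comp_def] using h2

end Measurability

/-! ### Gradients of test maps -/

section Gradient

variable {n N : ℕ} {Ω : Set (Vec n)} {φ : Vec n → Vec N}

lemma IsTestMap.continuous_grad (h : IsTestMap Ω φ) : Continuous (grad φ) := by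
  have h1 : Continuous (fderiv ℝ φ) := h.smooth.continuous_fderiv (by simp)
  unfold grad
  refine (PiLp.continuous_toLp 2 _).comp (continuous_pi fun ij => ?_)
  fun_prop

lemma IsTestMap.grad_eq_zero (h : IsTestMap Ω φ) {x : Vec n} (hx : x ∉ Ω) : grad φ x = 0 := by
  have h1 : fderiv ℝ φ x = 0 := by
    by_contra hne
    exact hx (h.subset (support_fderiv_subset ℝ hne))
  ext ij
  simp [grad, h1]

lemma IsTestMap.hasCompactSupport_grad (h : IsTestMap Ω φ) : HasCompactSupport (grad φ) := by
  refine HasCompactSupport.of_support_subset_isCompact (h.compact.fderiv (𝕜 := ℝ)) fun x hx => ?_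
  refine subset_tsupport _ fun h0 => hx ?_
  ext ij
  simp [grad, h0]

/-- Integration by parts against the constant 1; this supplies the mean-zero condition of the
interpolation inequality. -/
lemma IsTestMap.integral_grad (h : IsTestMap Ω φ) : ∫ x in Ω, grad φ x = 0 := by
  rw [setIntegral_eq_integral_of_forall_compl_eq_zero fun x hx => h.grad_eq_zero hx]
  have hi : Integrable (grad φ) :=
    h.continuous_grad.integrable_of_hasCompactSupport h.hasCompactSupport_grad
  have h1 : Continuous (fderiv ℝ φ) := h.smooth.continuous_fderiv (by simp)
  ext ij
  have h2 := (EuclideanSpace.proj (𝕜 := ℝ) ij).integral_comp_comm hi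
  have h4 : Integrable (fun x => fderiv ℝ φ x (EuclideanSpace.single ij.2 1)) := by
    refine Continuous.integrable_of_hasCompactSupport (by fun_prop) ?_
    exact (h.compact.fderiv (𝕜 := ℝ)).comp_left
      (g := fun T : Vec n →L[ℝ] Vec N => T (EuclideanSpace.single ij.2 1)) (by simp)
  have h3 : ∫ x, fderiv ℝ φ x (EuclideanSpace.single ij.2 1) = 0 := by
    have hd : Differentiable ℝ φ := h.smooth.differentiable (by simp)
    have hφi : Integrable φ := h.smooth.continuous.integrable_of_hasCompactSupport h.compact
    have := integral_smul_fderiv_eq_neg_fderiv_smul_of_integrable (𝕜 := ℝ) (μ := volume)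
      (f := fun _ : Vec n => (1 : ℝ)) (g := φ) (v := EuclideanSpace.single ij.2 1)
      (by simp) (by simpa using h4) (by simpa using hφi) (by fun_prop) (fun x _ => hd x)
    simpa using this
  have h5 := (EuclideanSpace.proj (𝕜 := ℝ) ij.1).integral_comp_comm h4
  rw [h3] at h5
  simp only [PiLp.proj_apply] at h2 h5
  rw [← h2]
  simpa [grad] using h5

end Gradient

/-! ### Local minimality in BMO -/

lemma setLIntegral_enorm_pow_eq {n : ℕ} {E : Type*} [NormedAddCommGroup E] {Ω : Set (Vec n)}
    {f : Vec n → E} (q : ℕ)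
    (hf : Integrable (fun x => ‖f x‖ ^ q) (volume.restrict Ω)) :
    ∫⁻ x in Ω, ‖f x‖ₑ ^ q = ENNReal.ofReal (∫ x in Ω, ‖f x‖ ^ q) := by
  rw [ofReal_integral_eq_lintegral_ofReal hf (ae_of_all _ fun x => by positivity)]
  refine lintegral_congr fun x => ?_
  rw [ENNReal.ofReal_pow (norm_nonneg _), ofReal_norm]

theorem theorem4p3 {n N : ℕ} (Ω : Set (Vec n)) (hΩ : IsLipschitzDomain Ω)
    (p : ℝ) (hp : 1 < p) (F : Vec n → Mat N n → ℝ)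
    (hF0 : HypReg Ω F) (hF1 : HypGrowth Ω p F) (hF2 : HypStrongQC Ω p F)
    (hqc : ∀ x₀ ∈ closure Ω, IsQuasiconvex (F x₀))
    (u : Vec n → Vec N) (Du : Vec n → Mat N n) (hu : MemW1Inf Ω u Du)
    (hext : ∀ φ : Vec n → Vec N, IsTestMap Ω φ →
      ∫ x in Ω, fderiv ℝ (F x) (Du x) (grad φ x) = 0)
    (c₃ : ℝ) (hc₃ : 0 < c₃)
    (hsec : ∀ φ : Vec n → Vec N, IsTestMap Ω φ →
      c₃ * ∫ x in Ω, ‖grad φ x‖ ^ 2 ≤ ∫ x in Ω, hessZ F x (Du x) (grad φ x) (grad φ x)) :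
    ∃ δ : ℝ, 0 < δ ∧ ∀ φ : Vec n → Vec N, IsTestMap Ω φ →
      bmoSeminorm Ω (grad φ) ≤ ENNReal.ofReal δ →
        ∫ x in Ω, F x (Du x) ≤ ∫ x in Ω, F x (Du x + grad φ x) := by
  have hp0 : 0 ≤ p := by linarith
  have hfin : IsFiniteMeasure (volume.restrict Ω) := ⟨by simpa using hΩ.bounded.measure_lt_top⟩
  set M : ℝ := (eLpNorm Du ⊤ (volume.restrict Ω)).toReal with hM
  have hM0 : 0 ≤ M := ENNReal.toReal_nonneg
  have hDu : ∀ᵐ x ∂volume.restrict Ω, ‖Du x‖ ≤ M := by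
    have h1 := hu.memLp_grad.2.ne
    rw [eLpNorm_exponent_top] at h1
    filter_upwards [ae_le_eLpNormEssSup (f := Du) (μ := volume.restrict Ω)] with x hx
    rw [hM, eLpNorm_exponent_top, ← ENNReal.ofReal_le_iff_le_toReal h1, ofReal_norm]
    exact hx
  have hin : ∀ᵐ x ∂volume.restrict Ω, x ∈ closure Ω :=
    (ae_restrict_mem hΩ.isOpen.measurableSet).mono fun x hx => subset_closure hx
  -- The interpolation inequality is for integer exponents j + 3, so p is rounded up.
  set j := ⌈p⌉₊ with hj
  have hpq : p ≤ ((j + 3 : ℕ) : ℝ) := by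
    have := Nat.le_ceil p; push_cast; linarith
  obtain ⟨C, hC0, hC⟩ := exists_remainder_bound hΩ.bounded hp0 hF0 hF1 hM0
    (q := j + 3) (by omega) hpq (ε := c₃ / 4) (by positivity)
  obtain ⟨B, hB0, hB⟩ := hF0.exists_bound hΩ.bounded M
  obtain ⟨B', hB'0, hB'⟩ := exists_fderiv_bound hΩ.bounded hp0 hF0 hF1 hM0
  -- Dividing by C + 1 instead of C covers C = 0.
  obtain ⟨δ, hδ, hδ'⟩ := hΩ.lintegral_pow_le_mul_lintegral_sq (E := Mat N n) j
    (ε := c₃ / (4 * (C + 1))) (by positivity)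
  refine ⟨δ, hδ, fun φ hφ hbmo => ?_⟩
  have hcont := hφ.continuous_grad
  have hcs := hφ.hasCompactSupport_grad
  have hpow : ∀ q : ℕ, q ≠ 0 → Integrable (fun x => ‖grad φ x‖ ^ q) (volume.restrict Ω) := by
    intro q hq
    refine (Continuous.integrable_of_hasCompactSupport (by fun_prop) ?_).restrict
    exact hcs.norm.comp_left (g := fun t : ℝ => t ^ q) (by simp [hq])
  have hinter : ∫ x in Ω, ‖grad φ x‖ ^ (j + 3)
      ≤ c₃ / (4 * (C + 1)) * ∫ x in Ω, ‖grad φ x‖ ^ 2 := by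
    have h1 := hδ' (grad φ) hcont hcs hφ.integral_grad hbmo
    rw [setLIntegral_enorm_pow_eq _ (hpow _ (by omega)),
      setLIntegral_enorm_pow_eq _ (hpow _ (by omega)),
      ← ENNReal.ofReal_mul (by positivity)] at h1
    refine (ENNReal.ofReal_le_ofReal_iff ?_).1 h1
    exact mul_nonneg (by positivity) (integral_nonneg fun x => by positivity)
  obtain ⟨Mφ, hMφ⟩ := hcs.exists_bound_of_continuous hcont
  have hDum := hu.memLp_grad.1
  have hgm : AEStronglyMeasurable (grad φ) (volume.restrict Ω) := hcont.aestronglyMeasurable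
  have hC2 : ∀ᵐ x ∂volume.restrict Ω, ContDiff ℝ 2 (F x) := hin.mono hF0.contDiff
  have hFc : ∀ᵐ x ∂volume.restrict Ω, Continuous (F x) := hC2.mono fun x h => h.continuous
  obtain ⟨c₁, hc₁, hgr⟩ := hF1
  have hint : ∀ (v : Vec n → Mat N n) (K : ℝ), AEStronglyMeasurable v (volume.restrict Ω) →
      (∀ᵐ x ∂volume.restrict Ω, ‖v x‖ ≤ K) →
      Integrable (fun x => F x (v x)) (volume.restrict Ω) := by
    intro v K hv hK
    refine Integrable.of_bound (aestronglyMeasurable_comp_of_continuous hF0.measurable hFc hv)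
      (c₁ * (1 + K ^ p)) ?_
    filter_upwards [hK, hin] with x hx hxΩ
    refine (hgr x hxΩ _).trans ?_
    gcongr
  have i1 : Integrable (fun x => F x (Du x)) (volume.restrict Ω) := hint _ M hDum hDu
  have i2 : Integrable (fun x => F x (Du x + grad φ x)) (volume.restrict Ω) := by
    refine hint _ (M + Mφ) (hDum.add hgm) ?_
    filter_upwards [hDu] with x hx
    exact (norm_add_le _ _).trans (add_le_add hx (hMφ x))
  have i3 : Integrable (fun x => fderiv ℝ (F x) (Du x) (grad φ x)) (volume.restrict Ω) := by
    refine Integrable.of_bound (aestronglyMeasurable_fderiv_comp hF0.measurable hC2 hDum hgm)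
      (B' * Mφ) ?_
    filter_upwards [hDu, hin] with x hx hxΩ
    exact ((fderiv ℝ (F x) (Du x)).le_opNorm _).trans
      (mul_le_mul (hB' x hxΩ _ hx) (hMφ x) (norm_nonneg _) hB'0)
  have i4 : Integrable (fun x => hessZ F x (Du x) (grad φ x) (grad φ x))
      (volume.restrict Ω) := by
    refine Integrable.of_bound
      (aestronglyMeasurable_fderiv_fderiv_comp hF0.measurable hC2 hDum hgm) (B * Mφ * Mφ) ?_
    filter_upwards [hDu, hin] with x hx hxΩ
    have hMφ0 : 0 ≤ Mφ := (norm_nonneg _).trans (hMφ x)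
    refine ((hessZ F x (Du x)).le_opNorm₂ _ _).trans ?_
    exact mul_le_mul (mul_le_mul (hB x hxΩ _ hx) (hMφ x) (norm_nonneg _) hB0) (hMφ x)
      (norm_nonneg _) (by positivity)
  have hmono : ∫ x in Ω, (F x (Du x) + fderiv ℝ (F x) (Du x) (grad φ x)
        + 1 / 2 * hessZ F x (Du x) (grad φ x) (grad φ x) - c₃ / 4 * ‖grad φ x‖ ^ 2
        - C * ‖grad φ x‖ ^ (j + 3))
      ≤ ∫ x in Ω, F x (Du x + grad φ x) := by
    refine integral_mono_ae ((((i1.add i3).add (i4.const_mul _)).sub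
      ((hpow 2 (by norm_num)).const_mul _)).sub ((hpow (j + 3) (by omega)).const_mul _)) i2 ?_
    filter_upwards [hDu, hin] with x hx hxΩ
    have := (abs_le.1 (hC x hxΩ (Du x) (grad φ x) hx)).1
    linarith
  have k1 : Integrable (fun x => F x (Du x) + fderiv ℝ (F x) (Du x) (grad φ x))
      (volume.restrict Ω) := i1.add i3
  have k2 : Integrable (fun x => F x (Du x) + fderiv ℝ (F x) (Du x) (grad φ x)
      + 1 / 2 * hessZ F x (Du x) (grad φ x) (grad φ x)) (volume.restrict Ω) :=
    k1.add (i4.const_mul _)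
  have k3 : Integrable (fun x => F x (Du x) + fderiv ℝ (F x) (Du x) (grad φ x)
      + 1 / 2 * hessZ F x (Du x) (grad φ x) (grad φ x) - c₃ / 4 * ‖grad φ x‖ ^ 2)
      (volume.restrict Ω) := k2.sub ((hpow 2 (by norm_num)).const_mul _)
  rw [integral_sub k3 ((hpow (j + 3) (by omega)).const_mul _),
    integral_sub k2 ((hpow 2 (by norm_num)).const_mul _),
    integral_add k1 (i4.const_mul _), integral_add i1 i3, hext φ hφ,
    integral_const_mul, integral_const_mul, integral_const_mul] at hmono
  have hs := hsec φ hφ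
  set I₂ := ∫ x in Ω, ‖grad φ x‖ ^ 2
  have hI₂ : 0 ≤ I₂ := integral_nonneg fun x => by positivity
  have hCq : C * ∫ x in Ω, ‖grad φ x‖ ^ (j + 3) ≤ c₃ / 4 * I₂ := by
    calc C * ∫ x in Ω, ‖grad φ x‖ ^ (j + 3)
        ≤ C * (c₃ / (4 * (C + 1)) * I₂) := mul_le_mul_of_nonneg_left hinter hC0
      _ = C / (C + 1) * (c₃ / 4 * I₂) := by field_simp
      _ ≤ 1 * (c₃ / 4 * I₂) := by
          gcongr
          rw [div_le_one (by positivity)]; linarith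
      _ = _ := one_mul _
  -- Balance: (c₃/2)∫|∇φ|² from half the second variation pays for c₃/4 from the Taylor remainder
  -- and c₃/4 from the power q.
  linarith
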